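/- For each $n$ let $\sigma_{1n},\dots,\sigma_{m_n n}>0$ be finitely many numbers with $\sum_j\sigma_{jn}^2=1$. Let $\xi_{1n},\dots,\xi_{m_nn}$ be independent random variables with $E\xi_{jn}=0$, $E\xi_{jn}^2=\sigma_{jn}^2$, and let $\eta_{1n},\dots,\eta_{m_nn}$ be independent with $\eta_{jn}\sim N(0,\sigma_{jn}^2)$. Put $t_{kn}=\sum_{j\le k}\sigma_{jn}^2$ for $0\le k\le m_n$, let $X_n$ and $Y_n$ be the random continuous piecewise linear functions on $[0,1]$ with vertices $(t_{kn},\sum_{j\le k}\xi_{jn})$ and $(t_{kn},\sum_{j\le k}\eta_{jn})$ respectively, and let $\sigma_n(t)=(E X_n(t)^2)^{1/2}$. Convergence in distribution of processes is weak convergence of their laws on $C[0,1]$ with the sup norm. (1) Let $\sigma:[0,1]\to[0,\infty)$. There is a continuous Gaussian process $Y$ on $[0,1]$ with $E Y(t)=0$ and $E Y(t)^2=\sigma^2(t)$ for all $t$ such that $Y_n$ converges in distribution to $Y$, if and only if $\sigma_n(t)\to\sigma(t)$ for every $t\in[0,1]$. (2) If $\max_j\sigma_{jn}\to0$, then $\sigma_n(t)\to\sqrt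 t$ for every $t\in[0,1]$ (so that $\sigma^2(t)=t$ in (1), and a limit exists), and every process $Y$ to which $Y_n$ converges in distribution is a standard Wiener process on $[0,1]$. (3) In general, if $Y_n$ converges in distribution to $Y$, then $[0,1]$ is the union of two disjoint sets $A$ and $B=[0,1]\setminus A$ such that $A$ is the union of an at most countable (possibly empty) family of segments $[c,d]$, $c<d$, on each of which $Y$ is almost surely linear (its path has the form $t\mapsto\alpha+\beta t$ with random $\alpha,\beta$), and such that for every segment $[a,b]\subset B$ the process $s\mapsto Y(a+s)-Y(a)$, $s\in[0,b-a]$, is a standard Wiener process on $[0,b-a]$. -/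

import Mathlib

open MeasureTheory ProbabilityTheory Filter Topology

/-- The space `C[0,1]` (with the sup norm) carries its Borel sigma-algebra. -/
noncomputable instance instMeasurableSpacePaths : MeasurableSpace C(unitInterval, ℝ) :=
  borel C(unitInterval, ℝ)

instance instBorelSpacePaths : BorelSpace C(unitInterval, ℝ) := ⟨rfl⟩

/-- The partial sum of the first `k` terms of a finite family. -/
def partialSum {m : ℕ} (x : Fin m → ℝ) (k : ℕ) : ℝ :=
  ∑ i ∈ Finset.univ.filter (fun i : Fin m => (i : ℕ) < k), x i

/-- The abscissas `t_k = ∑_{i < k} s_i ^ 2` of the vertices (`t_0 = 0`). -/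
def knot {m : ℕ} (s : Fin m → ℝ) (k : ℕ) : ℝ :=
  partialSum (fun i => s i ^ 2) k

/-- For `s_j > 0` with `∑ s_j ^ 2 = 1`: the continuous piecewise linear function on `[0,1]` with
vertices `(t_k, ∑_{i < k} x_i)`, `0 ≤ k ≤ m`. The `j`-th term of the sum is constant outside
`[t_j, t_{j+1}]` and grows linearly from `0` to `x_j` on that segment. -/
noncomputable def polygonal {m : ℕ} (s x : Fin m → ℝ) : C(unitInterval, ℝ) where
  toFun t := ∑ j : Fin m, x j * max 0 (min 1 (((t : ℝ) - knot s j) / s j ^ 2))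
  continuous_toFun := by fun_prop

theorem partialSum_mono {m : ℕ} {x : Fin m → ℝ} (hx : ∀ i, 0 ≤ x i) {k l : ℕ} (h : k ≤ l) :
    partialSum x k ≤ partialSum x l :=
  Finset.sum_le_sum_of_subset_of_nonneg
    (fun i hi => by
      simp only [Finset.mem_filter, Finset.mem_univ, true_and] at hi ⊢
      omega)
    (fun i _ _ => hx i)

theorem partialSum_succ {m : ℕ} (x : Fin m → ℝ) (j : Fin m) :
    partialSum x ((j : ℕ) + 1) = partialSum x j + x j := by
  have h : Finset.univ.filter (fun i : Fin m => (i : ℕ) < (j : ℕ) + 1)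
      = insert j (Finset.univ.filter (fun i : Fin m => (i : ℕ) < (j : ℕ))) := by
    ext i
    simp only [Finset.mem_filter, Finset.mem_univ, true_and, Finset.mem_insert, Fin.ext_iff]
    omega
  unfold partialSum
  rw [h, Finset.sum_insert (by simp), add_comm]

/-- On `[t_j, t_{j+1}]` the function `polygonal s x` is the linear interpolation between the
vertices `(t_j, ∑_{i < j} x_i)` and `(t_{j+1}, ∑_{i < j+1} x_i)`. -/
theorem polygonal_apply_of_mem {m : ℕ} (s x : Fin m → ℝ) (hs : ∀ j, 0 < s j) (j : Fin m)
    (t : unitInterval) (ht : (t : ℝ) ∈ Set.Icc (knot s j) (knot s ((j : ℕ) + 1))) :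
    polygonal s x t = partialSum x j + ((t : ℝ) - knot s j) / s j ^ 2 * x j := by
  have hsq : ∀ i, 0 < s i ^ 2 := fun i => pow_pos (hs i) 2
  have hsucc : ∀ i : Fin m, knot s ((i : ℕ) + 1) = knot s i + s i ^ 2 :=
    fun i => partialSum_succ _ i
  have hmono : ∀ {k l : ℕ}, k ≤ l → knot s k ≤ knot s l :=
    fun h => partialSum_mono (fun i => (hsq i).le) h
  have hx : x j = partialSum x ((j : ℕ) + 1) - partialSum x j := by
    rw [partialSum_succ]; ring
  have hp : polygonal s x t
      = ∑ i : Fin m, x i * max 0 (min 1 (((t : ℝ) - knot s i) / s i ^ 2)) := rfl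
  rw [hp, hx, partialSum, partialSum, Finset.sum_filter, Finset.sum_filter,
    ← Finset.sum_sub_distrib, Finset.mul_sum, ← Finset.sum_add_distrib]
  refine Finset.sum_congr rfl fun i _ => ?_
  rcases lt_trichotomy (i : ℕ) (j : ℕ) with h | h | h
  · have h1 : knot s ((i : ℕ) + 1) ≤ knot s j := hmono h
    have h2 : 1 ≤ ((t : ℝ) - knot s i) / s i ^ 2 := by
      rw [le_div_iff₀ (hsq i)]
      linarith [hsucc i, ht.1]
    have h3 : (i : ℕ) < (j : ℕ) + 1 := by omega
    simp [h, h3, min_eq_left h2]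
  · obtain rfl : i = j := Fin.ext h
    have h1 : 0 ≤ ((t : ℝ) - knot s i) / s i ^ 2 :=
      div_nonneg (by linarith [ht.1]) (hsq i).le
    have h2 : ((t : ℝ) - knot s i) / s i ^ 2 ≤ 1 := by
      rw [div_le_one (hsq i)]
      linarith [hsucc i, ht.2]
    simp [min_eq_right h2, max_eq_right h1, mul_comm]
  · have h1 : knot s ((j : ℕ) + 1) ≤ knot s i := hmono h
    have h2 : ((t : ℝ) - knot s i) / s i ^ 2 ≤ 0 :=
      div_nonpos_of_nonpos_of_nonneg (by linarith [ht.2]) (hsq i).le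
    have h3 : ¬ (i : ℕ) < (j : ℕ) + 1 := by omega
    have h4 : ¬ (i : ℕ) < (j : ℕ) := by omega
    simp [h3, h4, h2]

/-- The random polygonal function `ω ↦ polygonal s (x ω)` built from random variables `x_j`. -/
noncomputable def polygonalProcess {Ω : Type*} {m : ℕ} (s : Fin m → ℝ) (x : Fin m → Ω → ℝ) :
    Ω → C(unitInterval, ℝ) :=
  fun ω => polygonal s (fun j => x j ω)

/-- The function `t ↦ (E X(t)²)^{1/2}` of a random continuous function `X`. -/
noncomputable def rootSecondMoment {Ω : Type*} [MeasurableSpace Ω]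
    (X : Ω → C(unitInterval, ℝ)) (P : Measure Ω) (t : unitInterval) : ℝ :=
  √(∫ ω, X ω t ^ 2 ∂P)

/-- `Y` is a Gaussian process on `[0,1]` with `E Y(t) = 0` and `E Y(t)² = σ(t)²`. -/
structure IsCentredGaussianWith {Ω : Type*} [MeasurableSpace Ω] (σ : unitInterval → ℝ)
    (Y : Ω → C(unitInterval, ℝ)) (P : Measure Ω) : Prop where
  isGaussian : IsGaussianProcess (fun (t : unitInterval) (ω : Ω) => Y ω t) P
  mean_eq : ∀ t, ∫ ω, Y ω t ∂P = 0
  secondMoment_eq : ∀ t, ∫ ω, Y ω t ^ 2 ∂P = σ t ^ 2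

/-- `W` is a standard Wiener process on the time segment `[0,T]`. -/
structure IsWienerOn {Ω : Type*} [MeasurableSpace Ω] (T : ℝ) (W : Set.Icc (0 : ℝ) T → Ω → ℝ)
    (P : Measure Ω) : Prop where
  start : ∀ t : Set.Icc (0 : ℝ) T, (t : ℝ) = 0 → ∀ᵐ ω ∂P, W t ω = 0
  indep : HasIndepIncrements W P
  law : ∀ r t : Set.Icc (0 : ℝ) T, r ≤ t →
    HasLaw (fun ω => W t ω - W r ω) (gaussianReal 0 (Real.toNNReal ((t : ℝ) - r))) P
  continuous_paths : ∀ᵐ ω ∂P, Continuous fun t => W t ω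

/-- For `[a,b] ⊆ [0,1]` and `r ∈ [0, b - a]`, the point `a + r` of `[0,1]`. -/
def shiftPoint (a b : unitInterval) (r : Set.Icc (0 : ℝ) ((b : ℝ) - a)) : unitInterval :=
  ⟨(a : ℝ) + r, add_nonneg a.2.1 r.2.1, by linarith [r.2.2, b.2.2]⟩

/-- Almost surely, the path of `Y` is linear (i.e. of the form `c + d t`) on `[a,b]`. -/
def IsLinearOn {Ω : Type*} [MeasurableSpace Ω] (Y : Ω → C(unitInterval, ℝ)) (P : Measure Ω)
    (a b : unitInterval) : Prop :=
  ∀ᵐ ω ∂P, ∃ c d : ℝ, ∀ t ∈ Set.Icc a b, Y ω t = c + d * (t : ℝ)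

/-! ### Knots and ramps -/

section Ramp

variable {m : ℕ} {s : Fin m → ℝ}

/-! Let `ρ_j` be the ramp of the `j`-th segment between knots. The covariance of `Y_n` is `K_n(r,t)
= ∑ s_j² ρ_j(r) ρ_j(t)`, and `∑ s_j² ρ_j(r) = r`. So for `r ≤ t` the deficit from the Wiener
covariance, `r - K_n(r,t)`, is `B_n(r,t) = ∑ s_j² ρ_j(r) (1 - ρ_j(t)) ≥ 0`. It vanishes if a knot
separates `r` from `t`; inside one segment it is the covariance of a Brownian bridge. Since `σ_n(t)²
= K_n(t,t)`, the criterion concerns only the diagonal, and the main point is that the diagonal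
controls everything.

If the diagonals converge, the equi-Lipschitz functions `B_n(t,t)` converge uniformly to some `G`.
If `G` vanishes somewhere on `[r,t]`, then `B_n(r,t) → 0` (`bridgeKernel_le_diag`). If not,
eventually no knot lies in `[r,t]`, and `B_n(r,t)` is an explicit function of the two diagonal
values (`bridgeKernel_quadratic`). Hence all of `K_n` converges.

A limit process is obtained without a tightness argument. `Y_n` has the law of `I_n W`, where `W` is
a Wiener process (built by the Lévy–Ciesielski series) and `I_n` interpolates at the knots. As `I_n`
sends `min(·,t)` to `K_n(·,t)`, kills constants and has norm at most 2, convergence of the kernels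
and density of polygons give convergence of `I_n f` for every continuous `f`, hence of `I_n W` along
every path. Conversely, convergence in distribution of centred Gaussian processes forces their
covariances to converge (`IsCentredGaussianCov.of_tendstoInDistribution`).

Small mesh gives `B_n → 0`, so the limit covariance is `min`. In general `A = {G > 0}`: on a segment
inside `A` the paths of `Y_n` are eventually linear, which passes to the limit by the portmanteau
theorem; where `G = 0` the limit covariance is that of a Wiener process. -/

theorem knot_zero (s : Fin m → ℝ) : knot s 0 = 0 := by simp [knot, partialSum]

theorem knot_last (hsum : ∑ j, s j ^ 2 = 1) : knot s m = 1 := by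
  rw [← hsum, knot, partialSum, Finset.filter_true_of_mem fun i _ => i.2]

theorem knot_succ (s : Fin m → ℝ) (j : Fin m) : knot s ((j : ℕ) + 1) = knot s j + s j ^ 2 :=
  partialSum_succ _ j

theorem knot_monotone (s : Fin m → ℝ) : Monotone (knot s) :=
  fun _ _ h => partialSum_mono (fun i => sq_nonneg (s i)) h

theorem knot_nonneg (s : Fin m → ℝ) (k : ℕ) : 0 ≤ knot s k :=
  (knot_zero s).symm.le.trans (knot_monotone s k.zero_le)

theorem knot_le_one (hsum : ∑ j, s j ^ 2 = 1) (k : ℕ) : knot s k ≤ 1 := by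
  rw [← hsum]
  exact Finset.sum_le_sum_of_subset_of_nonneg
    (Finset.filter_subset (fun i : Fin m => (i : ℕ) < k) Finset.univ) fun i _ _ => sq_nonneg (s i)

theorem pos_of_sum_sq_eq_one (hsum : ∑ j, s j ^ 2 = 1) : 0 < m := by
  rcases Nat.eq_zero_or_pos m with rfl | h
  · simp at hsum
  · exact h

theorem exists_mem_knot_segment (hsum : ∑ j, s j ^ 2 = 1) {t : ℝ} (h0 : 0 ≤ t) (h1 : t ≤ 1) :
    ∃ j : Fin m, t ∈ Set.Icc (knot s j) (knot s ((j : ℕ) + 1)) := by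
  classical
  have hex : ∃ k, t ≤ knot s (k + 1) := ⟨m, by
    refine h1.trans ?_
    rw [← knot_last hsum]
    exact knot_monotone s m.le_succ⟩
  have hm := pos_of_sum_sq_eq_one hsum
  have hlt : Nat.find hex < m := by
    refine lt_of_le_of_lt (Nat.find_min' hex (m := m - 1) ?_) (by omega)
    rwa [Nat.sub_add_cancel hm, knot_last hsum]
  refine ⟨⟨Nat.find hex, hlt⟩, ?_, Nat.find_spec hex⟩
  change knot s (Nat.find hex) ≤ t
  rcases Nat.eq_zero_or_pos (Nat.find hex) with h | h
  · rw [h, knot_zero]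
    exact h0
  · have := Nat.find_min hex (m := Nat.find hex - 1) (by omega)
    rw [Nat.sub_add_cancel h] at this
    exact (not_le.1 this).le

/-- The function that grows linearly from `0` to `1` on the `j`-th segment between knots and is
constant elsewhere. -/
noncomputable def ramp (s : Fin m → ℝ) (j : Fin m) (t : ℝ) : ℝ :=
  max 0 (min 1 ((t - knot s j) / s j ^ 2))

theorem polygonal_apply (s x : Fin m → ℝ) (t : unitInterval) :
    polygonal s x t = ∑ j, x j * ramp s j t := rfl

theorem ramp_nonneg (s : Fin m → ℝ) (j : Fin m) (t : ℝ) : 0 ≤ ramp s j t := le_max_left _ _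

theorem ramp_le_one (s : Fin m → ℝ) (j : Fin m) (t : ℝ) : ramp s j t ≤ 1 :=
  max_le zero_le_one (min_le_left _ _)

theorem ramp_monotone (s : Fin m → ℝ) (j : Fin m) : Monotone (ramp s j) := fun r t h => by
  unfold ramp
  gcongr

theorem ramp_of_le {j : Fin m} {t : ℝ} (h : t ≤ knot s j) : ramp s j t = 0 :=
  max_eq_left ((min_le_right _ _).trans
    (div_nonpos_of_nonpos_of_nonneg (by linarith) (sq_nonneg _)))

theorem ramp_of_ge (hs : ∀ j, 0 < s j) {j : Fin m} {t : ℝ} (h : knot s ((j : ℕ) + 1) ≤ t) :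
    ramp s j t = 1 := by
  have h2 : 1 ≤ (t - knot s j) / s j ^ 2 := by
    rw [le_div_iff₀ (pow_pos (hs j) 2)]
    linarith [knot_succ s j]
  simp [ramp, min_eq_left h2]

theorem ramp_of_mem (hs : ∀ j, 0 < s j) {j : Fin m} {t : ℝ}
    (h : t ∈ Set.Icc (knot s j) (knot s ((j : ℕ) + 1))) :
    ramp s j t = (t - knot s j) / s j ^ 2 := by
  have h1 : 0 ≤ (t - knot s j) / s j ^ 2 := div_nonneg (by linarith [h.1]) (sq_nonneg _)
  have h2 : (t - knot s j) / s j ^ 2 ≤ 1 := by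
    rw [div_le_one (pow_pos (hs j) 2)]
    linarith [knot_succ s j, h.2]
  simp [ramp, min_eq_right h2, max_eq_right h1]

/-- Both sides measure the part of the `j`-th segment to the left of `t`. This form makes sums over
`j` telescope. -/
theorem sq_mul_ramp (hs : ∀ j, 0 < s j) (j : Fin m) (t : ℝ) :
    s j ^ 2 * ramp s j t = min (knot s ((j : ℕ) + 1)) t - min (knot s j) t := by
  have hsj := pow_pos (hs j) 2
  have h := knot_succ s j
  rcases le_total t (knot s j) with h1 | h1
  · rw [ramp_of_le h1, min_eq_right h1, min_eq_right (by linarith)]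
    ring
  · rcases le_total t (knot s ((j : ℕ) + 1)) with h2 | h2
    · rw [ramp_of_mem hs ⟨h1, h2⟩, min_eq_left h1, min_eq_right h2,
        mul_div_cancel₀ _ hsj.ne']
    · rw [ramp_of_ge hs h2, min_eq_left h1, min_eq_left h2]
      linarith

theorem sum_increments (F : ℕ → ℝ) (m : ℕ) :
    ∑ j : Fin m, (F ((j : ℕ) + 1) - F j) = F m - F 0 := by
  rw [Fin.sum_univ_eq_sum_range (fun j => F (j + 1) - F j), Finset.sum_range_sub]

theorem sum_sq_mul_ramp (hs : ∀ j, 0 < s j) (hsum : ∑ j, s j ^ 2 = 1) {t : ℝ} (h0 : 0 ≤ t)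
    (h1 : t ≤ 1) : ∑ j, s j ^ 2 * ramp s j t = t := by
  simp_rw [sq_mul_ramp hs]
  rw [sum_increments (fun k => min (knot s k) t), knot_last hsum, knot_zero, min_eq_right h1,
    min_eq_left h0, sub_zero]

/-- The covariance function of the polygonal process with independent increments of variances
`s j ^ 2`. -/
noncomputable def polygonalKernel (s : Fin m → ℝ) (r t : ℝ) : ℝ :=
  ∑ j, s j ^ 2 * (ramp s j r * ramp s j t)

/-- For `r ≤ t`, the difference between the Wiener covariance `r` and `polygonalKernel s r t`. -/
noncomputable def bridgeKernel (s : Fin m → ℝ) (r t : ℝ) : ℝ :=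
  ∑ j, s j ^ 2 * (ramp s j r * (1 - ramp s j t))

theorem polygonalKernel_comm (s : Fin m → ℝ) (r t : ℝ) :
    polygonalKernel s r t = polygonalKernel s t r := by
  simp [polygonalKernel, mul_comm (ramp s _ r)]

theorem polygonalKernel_add_bridgeKernel (hs : ∀ j, 0 < s j) (hsum : ∑ j, s j ^ 2 = 1) {r t : ℝ}
    (h0 : 0 ≤ r) (h1 : r ≤ 1) : polygonalKernel s r t + bridgeKernel s r t = r := by
  rw [polygonalKernel, bridgeKernel, ← Finset.sum_add_distrib]
  conv_rhs => rw [← sum_sq_mul_ramp hs hsum h0 h1]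
  exact Finset.sum_congr rfl fun j _ => by ring

theorem bridgeKernel_nonneg (s : Fin m → ℝ) (r t : ℝ) : 0 ≤ bridgeKernel s r t :=
  Finset.sum_nonneg fun j _ => mul_nonneg (sq_nonneg _)
    (mul_nonneg (ramp_nonneg s j r) (sub_nonneg.2 (ramp_le_one s j t)))

/-- Termwise, by monotonicity of the ramps. A single zero of the diagonal thus annihilates the
kernel across it. -/
theorem bridgeKernel_le_diag (s : Fin m → ℝ) {r k t : ℝ} (hrk : r ≤ k) (hkt : k ≤ t) :
    bridgeKernel s r t ≤ bridgeKernel s k k :=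
  Finset.sum_le_sum fun j _ => mul_le_mul_of_nonneg_left
    (mul_le_mul (ramp_monotone s j hrk) (sub_le_sub_left (ramp_monotone s j hkt) _)
      (sub_nonneg.2 (ramp_le_one s j t)) (ramp_nonneg s j k)) (sq_nonneg _)

/-- Only the `j`-th summand survives: earlier ramps are already 1 at `t`, later ones still 0 at `r`.
What remains is a Brownian bridge covariance. -/
theorem bridgeKernel_of_mem (hs : ∀ j, 0 < s j) {j : Fin m} {r t : ℝ} (hrt : r ≤ t)
    (hr : knot s j ≤ r) (ht : t ≤ knot s ((j : ℕ) + 1)) :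
    bridgeKernel s r t = (r - knot s j) * (knot s ((j : ℕ) + 1) - t) / s j ^ 2 := by
  rw [bridgeKernel, Finset.sum_eq_single j]
  · rw [ramp_of_mem hs ⟨hr, hrt.trans ht⟩, ramp_of_mem hs ⟨hr.trans hrt, ht⟩, knot_succ]
    have := (hs j).ne'
    field_simp
    ring
  · intro i _ hij
    rcases lt_or_gt_of_ne hij with h | h
    · rw [ramp_of_ge hs ((knot_monotone s (Nat.succ_le_of_lt h)).trans (hr.trans hrt))]
      ring
    · rw [ramp_of_le ((hrt.trans ht).trans (knot_monotone s (Nat.succ_le_of_lt h)))]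
      ring
  · simp

theorem bridgeKernel_knot (hs : ∀ j, 0 < s j) (k : ℕ) :
    bridgeKernel s (knot s k) (knot s k) = 0 := by
  refine Finset.sum_eq_zero fun j _ => ?_
  rcases lt_or_ge (j : ℕ) k with h | h
  · rw [ramp_of_ge hs (knot_monotone s h)]
    ring
  · rw [ramp_of_le (knot_monotone s h)]
    ring

/-- A segment on which the diagonal of the bridge kernel does not vanish contains no knot. -/
theorem exists_segment_of_bridgeKernel_pos (hs : ∀ j, 0 < s j) (hsum : ∑ j, s j ^ 2 = 1) {r t : ℝ}
    (h0 : 0 ≤ r) (hrt : r ≤ t) (h1 : t ≤ 1)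
    (h : ∀ k ∈ Set.Icc r t, 0 < bridgeKernel s k k) :
    ∃ j : Fin m, knot s j ≤ r ∧ t ≤ knot s ((j : ℕ) + 1) := by
  obtain ⟨j, hj⟩ := exists_mem_knot_segment hsum h0 (hrt.trans h1)
  refine ⟨j, hj.1, not_lt.1 fun hlt => ?_⟩
  have := h _ ⟨hj.2, hlt.le⟩
  rw [bridgeKernel_knot hs] at this
  exact lt_irrefl _ this

/-- With `x = B(r,t)`, the bridge formula gives `x (x + (t - r)) = B(r,r) B(t,t)`; the value is the
nonnegative root. The knots no longer appear. -/
theorem bridgeKernel_quadratic (hs : ∀ j, 0 < s j) {j : Fin m} {r t : ℝ} (hrt : r ≤ t)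
    (hr : knot s j ≤ r) (ht : t ≤ knot s ((j : ℕ) + 1)) :
    bridgeKernel s r t =
      (-(t - r) + √((t - r) ^ 2 + 4 * (bridgeKernel s r r * bridgeKernel s t t))) / 2 := by
  have key : (t - r) ^ 2 + 4 * (bridgeKernel s r r * bridgeKernel s t t)
      = (2 * bridgeKernel s r t + (t - r)) ^ 2 := by
    rw [bridgeKernel_of_mem hs hrt hr ht, bridgeKernel_of_mem hs le_rfl hr (hrt.trans ht),
      bridgeKernel_of_mem hs le_rfl (hr.trans hrt) ht, knot_succ]
    have := (hs j).ne'
    field_simp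
    ring
  rw [key, Real.sqrt_sq (by linarith [bridgeKernel_nonneg s r t])]
  ring

theorem bridgeKernel_diag_le (hs : ∀ j, 0 < s j) (hsum : ∑ j, s j ^ 2 = 1) {t : ℝ}
    (h0 : 0 ≤ t) (h1 : t ≤ 1) : ∃ j, bridgeKernel s t t ≤ s j ^ 2 := by
  obtain ⟨j, hj⟩ := exists_mem_knot_segment hsum h0 h1
  refine ⟨j, ?_⟩
  have hsj := pow_pos (hs j) 2
  rw [bridgeKernel_of_mem hs le_rfl hj.1 hj.2, div_le_iff₀ hsj]
  have := knot_succ s j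
  exact mul_le_mul (by linarith [hj.2]) (by linarith [hj.1]) (by linarith [hj.2]) hsj.le

/-- The ramp increments are nonnegative, their weighted sum is `r - r'`, and the other factor is at
most 1. The bound is uniform in the partition, which upgrades pointwise to uniform convergence. -/
theorem abs_polygonalKernel_sub_le (hs : ∀ j, 0 < s j) (hsum : ∑ j, s j ^ 2 = 1) {r r' t : ℝ}
    (hr : r ∈ Set.Icc (0 : ℝ) 1) (hr' : r' ∈ Set.Icc (0 : ℝ) 1) :
    |polygonalKernel s r t - polygonalKernel s r' t| ≤ |r - r'| := by
  wlog h : r' ≤ r generalizing r r'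
  · rw [abs_sub_comm, abs_sub_comm r]
    exact this hr' hr (le_of_not_ge h)
  have e : polygonalKernel s r t - polygonalKernel s r' t
      = ∑ j, s j ^ 2 * ((ramp s j r - ramp s j r') * ramp s j t) := by
    rw [polygonalKernel, polygonalKernel, ← Finset.sum_sub_distrib]
    exact Finset.sum_congr rfl fun j _ => by ring
  have hd : ∀ j, 0 ≤ ramp s j r - ramp s j r' := fun j => sub_nonneg.2 (ramp_monotone s j h)
  have e2 : r - r' = ∑ j, s j ^ 2 * (ramp s j r - ramp s j r') := by
    simp_rw [mul_sub]
    rw [Finset.sum_sub_distrib, sum_sq_mul_ramp hs hsum hr.1 hr.2,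
      sum_sq_mul_ramp hs hsum hr'.1 hr'.2]
  rw [abs_of_nonneg (sub_nonneg.2 h), abs_of_nonneg, e, e2]
  · exact Finset.sum_le_sum fun j _ => mul_le_mul_of_nonneg_left
      (mul_le_of_le_one_right (hd j) (ramp_le_one s j t)) (sq_nonneg _)
  · rw [e]
    exact Finset.sum_nonneg fun j _ => mul_nonneg (sq_nonneg _)
      (mul_nonneg (hd j) (ramp_nonneg s j t))

end Ramp

/-! ### Pointwise convergence of equi-Lipschitz functions -/

theorem exists_tendsto_of_lipschitz {f : ℕ → C(unitInterval, ℝ)} {K : NNReal}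
    (hf : ∀ n, LipschitzWith K (f n)) (hlim : ∀ t, ∃ l, Tendsto (fun n => f n t) atTop (𝓝 l)) :
    ∃ F : C(unitInterval, ℝ), Tendsto f atTop (𝓝 F) := by
  choose F hF using hlim
  have heq : Equicontinuous (fun n t => f n t) :=
    (LipschitzWith.uniformEquicontinuous _ K hf).equicontinuous
  have hpt : Tendsto (fun n t => f n t) atTop (𝓝 F) := tendsto_pi_nhds.2 hF
  have hun : TendstoUniformly (fun n t => f n t) F atTop := by
    have := (heq.tendsto_uniformFun_iff_pi atTop F).2 hpt
    exact UniformFun.tendsto_iff_tendstoUniformly.1 this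
  exact ⟨⟨F, hun.continuous (Frequently.of_forall fun n => (f n).continuous)⟩,
    ContinuousMap.tendsto_iff_tendstoUniformly.2 hun⟩

/-! ### Convergence of the kernels -/

section KernelLimit

@[fun_prop]
theorem continuous_ramp {m : ℕ} (s : Fin m → ℝ) (j : Fin m) : Continuous (ramp s j) := by
  unfold ramp
  fun_prop

/-- The diagonal of the bridge kernel as a continuous function on `[0,1]`. -/
noncomputable def bridgeDiag {m : ℕ} (s : Fin m → ℝ) : C(unitInterval, ℝ) where
  toFun t := bridgeKernel s t t
  continuous_toFun := by
    unfold bridgeKernel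
    fun_prop

theorem bridgeDiag_apply {m : ℕ} (s : Fin m → ℝ) (t : unitInterval) :
    bridgeDiag s t = bridgeKernel s t t := rfl

theorem bridgeDiag_eq {m : ℕ} {s : Fin m → ℝ} (hs : ∀ j, 0 < s j) (hsum : ∑ j, s j ^ 2 = 1)
    (t : unitInterval) : bridgeDiag s t = t - polygonalKernel s t t := by
  rw [bridgeDiag_apply]
  linarith [polygonalKernel_add_bridgeKernel (t := (t : ℝ)) hs hsum t.2.1 t.2.2]

/-- The diagonal is `t - K(t,t)`: one unit of the constant comes from `t`, one from each argument of
`K`, moved in turn. -/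
theorem lipschitzWith_bridgeDiag {m : ℕ} {s : Fin m → ℝ} (hs : ∀ j, 0 < s j)
    (hsum : ∑ j, s j ^ 2 = 1) : LipschitzWith 3 (bridgeDiag s) := by
  refine LipschitzWith.of_dist_le_mul fun r t => ?_
  rw [bridgeDiag_eq hs hsum, bridgeDiag_eq hs hsum, Real.dist_eq, Subtype.dist_eq, Real.dist_eq]
  have h1 := abs_polygonalKernel_sub_le (t := (r : ℝ)) hs hsum r.2 t.2
  have h2 := abs_polygonalKernel_sub_le (t := (t : ℝ)) hs hsum r.2 t.2
  rw [polygonalKernel_comm s t r] at h1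
  rw [show ((r : ℝ) - polygonalKernel s r r - (t - polygonalKernel s t t))
    = (r - t) - ((polygonalKernel s r r - polygonalKernel s r t)
      + (polygonalKernel s r t - polygonalKernel s t t)) by ring]
  refine (abs_sub _ _).trans ?_
  have h3 := abs_add_le (polygonalKernel s r r - polygonalKernel s r t)
    (polygonalKernel s r t - polygonalKernel s t t)
  push_cast
  linarith

variable {m : ℕ → ℕ} {s : (n : ℕ) → Fin (m n) → ℝ}

theorem exists_tendsto_bridgeDiag (hs : ∀ n j, 0 < s n j) (hsum : ∀ n, ∑ j, s n j ^ 2 = 1)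
    {c : unitInterval → ℝ}
    (hdiag : ∀ t : unitInterval, Tendsto (fun n => polygonalKernel (s n) t t) atTop (𝓝 (c t))) :
    ∃ G : C(unitInterval, ℝ), (∀ t : unitInterval, G t = t - c t) ∧
      Tendsto (fun n => bridgeDiag (s n)) atTop (𝓝 G) := by
  have hpt : ∀ t : unitInterval,
      Tendsto (fun n => bridgeDiag (s n) t) atTop (𝓝 ((t : ℝ) - c t)) := fun t => by
    simp_rw [fun n => bridgeDiag_eq (hs n) (hsum n) t]
    exact tendsto_const_nhds.sub (hdiag t)
  obtain ⟨G, hG⟩ := exists_tendsto_of_lipschitz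
    (fun n => lipschitzWith_bridgeDiag (hs n) (hsum n)) fun t => ⟨_, hpt t⟩
  exact ⟨G, fun t => tendsto_nhds_unique
    (((continuous_eval_const (F := C(unitInterval, ℝ)) t).tendsto G).comp hG) (hpt t), hG⟩

/-- `G` has a positive minimum on the compact `[r,t]`; once the uniform distance is below it, the
diagonal has no zero there, hence there is no knot. -/
theorem eventually_exists_segment (hs : ∀ n j, 0 < s n j) (hsum : ∀ n, ∑ j, s n j ^ 2 = 1)
    {G : C(unitInterval, ℝ)} (hG : Tendsto (fun n => bridgeDiag (s n)) atTop (𝓝 G))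
    {r t : unitInterval} (hrt : r ≤ t) (hpos : ∀ k ∈ Set.Icc r t, 0 < G k) :
    ∀ᶠ n in atTop, ∃ j : Fin (m n), knot (s n) j ≤ r ∧ (t : ℝ) ≤ knot (s n) ((j : ℕ) + 1) := by
  obtain ⟨k₀, hk₀, hmin⟩ := isCompact_Icc.exists_isMinOn ⟨r, Set.left_mem_Icc.2 hrt⟩
    G.continuous.continuousOn
  filter_upwards [Metric.tendsto_nhds.1 hG (G k₀) (hpos k₀ hk₀)] with n hn
  refine exists_segment_of_bridgeKernel_pos (hs n) (hsum n) r.2.1 hrt t.2.2 fun k hk => ?_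
  let k' : unitInterval := ⟨k, r.2.1.trans hk.1, hk.2.trans t.2.2⟩
  have h1 := (ContinuousMap.dist_apply_le_dist k').trans_lt hn
  have h2 : G k₀ ≤ G k' := hmin ⟨hk.1, hk.2⟩
  rw [Real.dist_eq, abs_lt] at h1
  change 0 < bridgeDiag (s n) k'
  linarith

/-- Either `G` is positive on `[r,t]` and the quadratic formula passes to the limit, or `G` has a
zero there and the bridge kernel is squeezed to 0. -/
theorem exists_tendsto_polygonalKernel (hs : ∀ n j, 0 < s n j) (hsum : ∀ n, ∑ j, s n j ^ 2 = 1)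
    {c : unitInterval → ℝ}
    (hdiag : ∀ t : unitInterval, Tendsto (fun n => polygonalKernel (s n) t t) atTop (𝓝 (c t)))
    (r t : unitInterval) : ∃ l, Tendsto (fun n => polygonalKernel (s n) r t) atTop (𝓝 l) := by
  wlog hrt : r ≤ t generalizing r t
  · simp_rw [fun n => polygonalKernel_comm (s n) r t]
    exact this t r (le_of_not_ge hrt)
  obtain ⟨G, -, hG⟩ := exists_tendsto_bridgeDiag hs hsum hdiag
  have hev : ∀ k : unitInterval, Tendsto (fun n => bridgeKernel (s n) k k) atTop (𝓝 (G k)) :=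
    fun k => ((continuous_eval_const (F := C(unitInterval, ℝ)) k).tendsto G).comp hG
  suffices h : ∃ l, Tendsto (fun n => bridgeKernel (s n) r t) atTop (𝓝 l) by
    obtain ⟨l, hl⟩ := h
    refine ⟨r - l, (tendsto_const_nhds.sub hl).congr fun n => ?_⟩
    linarith [polygonalKernel_add_bridgeKernel (t := (t : ℝ)) (hs n) (hsum n) r.2.1 r.2.2]
  by_cases hpos : ∀ k ∈ Set.Icc r t, 0 < G k
  · have hlim : Tendsto (fun n => (-((t : ℝ) - r) + √(((t : ℝ) - r) ^ 2
        + 4 * (bridgeKernel (s n) r r * bridgeKernel (s n) t t))) / 2) atTop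
        (𝓝 ((-((t : ℝ) - r) + √(((t : ℝ) - r) ^ 2 + 4 * (G r * G t))) / 2)) :=
      (tendsto_const_nhds.add (tendsto_const_nhds.add
        (((hev r).mul (hev t)).const_mul 4)).sqrt).div_const 2
    refine ⟨_, hlim.congr' ?_⟩
    filter_upwards [eventually_exists_segment hs hsum hG hrt hpos] with n ⟨j, hj1, hj2⟩
    exact (bridgeKernel_quadratic (hs n) hrt hj1 hj2).symm
  · push Not at hpos
    obtain ⟨k, hk, hGk⟩ := hpos
    have hk0 : G k = 0 := le_antisymm hGk
      (ge_of_tendsto' (hev k) fun n => bridgeKernel_nonneg _ _ _)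
    refine ⟨0, squeeze_zero (fun n => bridgeKernel_nonneg _ _ _)
      (fun n => bridgeKernel_le_diag (s n) hk.1 hk.2) (hk0 ▸ hev k)⟩

end KernelLimit

/-! ### Polygonal interpolation -/

section Interpolation

variable {m : ℕ} {s : Fin m → ℝ}

/-- The knot `t_k` as a point of `[0,1]`. -/
noncomputable def knotPoint (s : Fin m → ℝ) (hsum : ∑ j, s j ^ 2 = 1) (k : ℕ) : unitInterval :=
  ⟨knot s k, knot_nonneg s k, knot_le_one hsum k⟩

/-- Interpolation at the knots of the function `f - f 0`. -/
noncomputable def polygonalInterp (s : Fin m → ℝ) (hsum : ∑ j, s j ^ 2 = 1) :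
    C(unitInterval, ℝ) →ₗ[ℝ] C(unitInterval, ℝ) where
  toFun f := polygonal s fun j => f (knotPoint s hsum ((j : ℕ) + 1)) - f (knotPoint s hsum j)
  map_add' f g := by
    ext t
    simp only [polygonal_apply, ContinuousMap.add_apply, ← Finset.sum_add_distrib]
    exact Finset.sum_congr rfl fun j _ => by ring
  map_smul' c f := by
    ext t
    simp only [polygonal_apply, ContinuousMap.smul_apply, smul_eq_mul, RingHom.id_apply,
      Finset.mul_sum]
    exact Finset.sum_congr rfl fun j _ => by ring

theorem polygonalInterp_def (hsum : ∑ j, s j ^ 2 = 1) (f : C(unitInterval, ℝ)) :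
    polygonalInterp s hsum f =
      polygonal s fun j => f (knotPoint s hsum ((j : ℕ) + 1)) - f (knotPoint s hsum j) := rfl

theorem partialSum_increments (F : ℕ → ℝ) {k : ℕ} (hk : k ≤ m) :
    partialSum (fun j : Fin m => F ((j : ℕ) + 1) - F j) k = F k - F 0 := by
  induction k with
  | zero => simp [partialSum]
  | succ k ih =>
    rw [partialSum_succ _ (⟨k, hk⟩ : Fin m), ih (by omega)]
    ring

/-- Up to the shift by `f 0`, each value is a convex combination of two neighbouring knot values;
the norm and approximation bounds follow from this. -/
theorem exists_polygonalInterp_eq (hs : ∀ j, 0 < s j) (hsum : ∑ j, s j ^ 2 = 1)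
    (f : C(unitInterval, ℝ)) (t : unitInterval) :
    ∃ (j : Fin m) (u : ℝ), 0 ≤ u ∧ u ≤ 1 ∧
      (t : ℝ) ∈ Set.Icc (knot s j) (knot s ((j : ℕ) + 1)) ∧
      polygonalInterp s hsum f t = (1 - u) * f (knotPoint s hsum j)
        + u * f (knotPoint s hsum ((j : ℕ) + 1)) - f 0 := by
  obtain ⟨j, hj⟩ := exists_mem_knot_segment hsum t.2.1 t.2.2
  refine ⟨j, ramp s j t, ramp_nonneg _ _ _, ramp_le_one _ _ _, hj, ?_⟩
  rw [polygonalInterp_def, polygonal_apply_of_mem _ _ hs j t hj,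
    partialSum_increments (fun k => f (knotPoint s hsum k)) j.2.le, ramp_of_mem hs hj]
  have h0 : knotPoint s hsum 0 = 0 := Subtype.ext (knot_zero s)
  simp only [h0]
  ring

theorem norm_polygonalInterp_le (hs : ∀ j, 0 < s j) (hsum : ∑ j, s j ^ 2 = 1)
    (f : C(unitInterval, ℝ)) : ‖polygonalInterp s hsum f‖ ≤ 2 * ‖f‖ := by
  refine (ContinuousMap.norm_le _ (by positivity)).2 fun t => ?_
  obtain ⟨j, u, hu0, hu1, -, h⟩ := exists_polygonalInterp_eq hs hsum f t
  have hb : ∀ x, -‖f‖ ≤ f x ∧ f x ≤ ‖f‖ := fun x => abs_le.1 (f.norm_coe_le_norm x)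
  rw [h, Real.norm_eq_abs, abs_le]
  constructor <;> nlinarith [hb 0, hb (knotPoint s hsum j), hb (knotPoint s hsum ((j : ℕ) + 1))]

theorem norm_polygonalInterp_sub_le (hs : ∀ j, 0 < s j) (hsum : ∑ j, s j ^ 2 = 1)
    {f : C(unitInterval, ℝ)} {δ ε : ℝ} (hδ : ∀ j, s j ^ 2 < δ) (hε : 0 ≤ ε)
    (hf : ∀ x y : unitInterval, dist x y < δ → dist (f x) (f y) < ε) :
    ‖f - ContinuousMap.const _ (f 0) - polygonalInterp s hsum f‖ ≤ ε := by
  refine (ContinuousMap.norm_le _ hε).2 fun t => ?_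
  obtain ⟨j, u, hu0, hu1, hj, h⟩ := exists_polygonalInterp_eq hs hsum f t
  have hsj := knot_succ s j
  have h1 := hf (knotPoint s hsum j) t (by
    rw [Subtype.dist_eq, Real.dist_eq, abs_lt]
    change -δ < knot s j - t ∧ knot s j - t < δ
    constructor <;> linarith [hδ j, hj.1, hj.2, sq_nonneg (s j)])
  have h2 := hf (knotPoint s hsum ((j : ℕ) + 1)) t (by
    rw [Subtype.dist_eq, Real.dist_eq, abs_lt]
    change -δ < knot s ((j : ℕ) + 1) - t ∧ knot s ((j : ℕ) + 1) - t < δ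
    constructor <;> linarith [hδ j, hj.1, hj.2, sq_nonneg (s j)])
  rw [Real.dist_eq, abs_lt] at h1 h2
  rw [ContinuousMap.sub_apply, ContinuousMap.sub_apply, h, ContinuousMap.const_apply,
    Real.norm_eq_abs, abs_le]
  constructor <;> nlinarith

/-- The function `r ↦ min r t`, i.e. the Wiener covariance with one argument fixed. -/
noncomputable def minFunction (t : ℝ) : C(unitInterval, ℝ) where
  toFun r := min (r : ℝ) t
  continuous_toFun := by fun_prop

/-- By `sq_mul_ramp`, the increment of `min(·,t)` over the `j`-th segment is `s_j² ρ_j(t)`. -/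
theorem polygonalInterp_minFunction (hs : ∀ j, 0 < s j) (hsum : ∑ j, s j ^ 2 = 1) (t : ℝ)
    (r : unitInterval) : polygonalInterp s hsum (minFunction t) r = polygonalKernel s r t := by
  rw [polygonalInterp_def, polygonal_apply, polygonalKernel]
  refine Finset.sum_congr rfl fun j _ => ?_
  rw [mul_left_comm, sq_mul_ramp hs, mul_comm]
  rfl

theorem polygonal_eq_sum_minFunction (hs : ∀ j, 0 < s j) (x : Fin m → ℝ) :
    polygonal s x = ∑ j, (x j / s j ^ 2) •
      (minFunction (knot s ((j : ℕ) + 1)) - minFunction (knot s j)) := by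
  ext t
  rw [polygonal_apply, ContinuousMap.sum_apply]
  refine Finset.sum_congr rfl fun j _ => ?_
  have h : s j ^ 2 * ramp s j t = _ := sq_mul_ramp hs j t
  rw [ContinuousMap.smul_apply, ContinuousMap.sub_apply, smul_eq_mul]
  change _ = x j / s j ^ 2 * (min (t : ℝ) _ - min (t : ℝ) _)
  rw [min_comm (t : ℝ), min_comm (t : ℝ), ← h]
  have := (hs j).ne'
  field_simp

theorem polygonalInterp_const (hsum : ∑ j, s j ^ 2 = 1) (c : ℝ) :
    polygonalInterp s hsum (ContinuousMap.const _ c) = 0 := by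
  ext t
  simp [polygonalInterp_def, polygonal_apply]

/-- The equal steps `1 / √(N + 1)` generate the equidistant partition of `[0,1]`. -/
theorem sum_sq_equidistant (N : ℕ) : ∑ _j : Fin (N + 1), (√((N : ℝ) + 1))⁻¹ ^ 2 = 1 := by
  have h : (0 : ℝ) ≤ (N : ℝ) + 1 := by positivity
  rw [Finset.sum_const, Finset.card_univ, Fintype.card_fin, inv_pow, Real.sq_sqrt h, nsmul_eq_mul]
  push_cast
  exact mul_inv_cancel₀ (by positivity)

theorem exists_polygonal_near (f : C(unitInterval, ℝ)) {ε : ℝ} (hε : 0 < ε) :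
    ∃ (N : ℕ) (s x : Fin N → ℝ), (∀ j, 0 < s j) ∧ ∑ j, s j ^ 2 = 1 ∧
      ‖f - ContinuousMap.const _ (f 0) - polygonal s x‖ ≤ ε := by
  obtain ⟨δ, hδ, h⟩ := Metric.uniformContinuous_iff.1
    (CompactSpace.uniformContinuous_of_continuous f.continuous) ε hε
  obtain ⟨N, hN⟩ := exists_nat_one_div_lt hδ
  refine ⟨N + 1, fun _ => (√((N : ℝ) + 1))⁻¹, _, fun _ => by positivity,
    sum_sq_equidistant N, norm_polygonalInterp_sub_le (fun _ => by positivity) (sum_sq_equidistant N) (fun _ => ?_) hε.le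
      fun x y hxy => h hxy⟩
  rw [inv_pow, Real.sq_sqrt (by positivity), ← one_div]
  exact hN

variable {m : ℕ → ℕ} {s : (n : ℕ) → Fin (m n) → ℝ}

/-- Convergence holds for `min(·,t)` by convergence of the kernels, hence for polygons, which are
combinations of these; uniform boundedness extends it to all `f`. -/
theorem exists_tendsto_polygonalInterp (hs : ∀ n j, 0 < s n j) (hsum : ∀ n, ∑ j, s n j ^ 2 = 1)
    {c : unitInterval → ℝ}
    (hdiag : ∀ t : unitInterval, Tendsto (fun n => polygonalKernel (s n) t t) atTop (𝓝 (c t)))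
    (f : C(unitInterval, ℝ)) :
    ∃ F, Tendsto (fun n => polygonalInterp (s n) (hsum n) f) atTop (𝓝 F) := by
  have hmin : ∀ t : unitInterval, ∃ F,
      Tendsto (fun n => polygonalInterp (s n) (hsum n) (minFunction t)) atTop (𝓝 F) := fun t => by
    refine exists_tendsto_of_lipschitz (K := 1) (fun n => ?_) fun r => ?_
    · refine LipschitzWith.of_dist_le_mul fun r r' => ?_
      rw [polygonalInterp_minFunction (hs n), polygonalInterp_minFunction (hs n), Real.dist_eq,
        Subtype.dist_eq, Real.dist_eq, NNReal.coe_one, one_mul]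
      exact abs_polygonalKernel_sub_le (hs n) (hsum n) r.2 r'.2
    · simp_rw [fun n => polygonalInterp_minFunction (hs n) (hsum n) t r]
      exact exists_tendsto_polygonalKernel hs hsum hdiag r t
  have hpoly : ∀ (N : ℕ) (s' x : Fin N → ℝ), (∀ j, 0 < s' j) → (∑ j, s' j ^ 2 = 1) → ∃ F,
      Tendsto (fun n => polygonalInterp (s n) (hsum n) (polygonal s' x)) atTop (𝓝 F) := by
    intro N s' x hs' hsum'
    choose F hF using hmin
    rw [polygonal_eq_sum_minFunction hs']
    simp_rw [map_sum, map_smul, map_sub]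
    exact ⟨_, tendsto_finsetSum _ fun j _ => ((hF (knotPoint s' hsum' ((j : ℕ) + 1))).sub
      (hF (knotPoint s' hsum' j))).const_smul _⟩
  refine cauchySeq_tendsto_of_complete (Metric.cauchySeq_iff'.2 fun ε hε => ?_)
  -- The operator norm 2 turns `ε / 8` into `ε / 4`, and three such terms stay below `ε`.
  obtain ⟨N, s', x, hs', hsum', hp⟩ := exists_polygonal_near f (ε := ε / 8) (by positivity)
  obtain ⟨F, hF⟩ := hpoly N s' x hs' hsum'
  obtain ⟨N₀, hN₀⟩ := Metric.cauchySeq_iff'.1 hF.cauchySeq (ε / 4) (by positivity)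
  have hclose : ∀ n, dist (polygonalInterp (s n) (hsum n) f)
      (polygonalInterp (s n) (hsum n) (polygonal s' x)) ≤ ε / 4 := fun n => by
    have h := norm_polygonalInterp_le (hs n) (hsum n)
      (f - ContinuousMap.const _ (f 0) - polygonal s' x)
    rw [map_sub, map_sub, polygonalInterp_const, sub_zero] at h
    rw [dist_eq_norm]
    linarith
  refine ⟨N₀, fun n hn => ?_⟩
  have h1 := hclose n
  have h2 := hclose N₀
  have h3 := hN₀ n hn
  have h4 := dist_triangle4_right (polygonalInterp (s n) (hsum n) f)
    (polygonalInterp (s N₀) (hsum N₀) f) (polygonalInterp (s n) (hsum n) (polygonal s' x))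
    (polygonalInterp (s N₀) (hsum N₀) (polygonal s' x))
  linarith

end Interpolation

/-! ### Centred Gaussian processes with a given covariance -/

/-- `X` is a centred Gaussian process with covariance function `K`. -/
structure IsCentredGaussianCov {T Ω : Type*} [MeasurableSpace Ω] (X : T → Ω → ℝ) (K : T → T → ℝ)
    (P : Measure Ω) : Prop where
  isGaussian : IsGaussianProcess X P
  mean_eq : ∀ t, ∫ ω, X t ω ∂P = 0
  cov_eq : ∀ r t, cov[X r, X t; P] = K r t

section CentredGaussian

variable {T Ω : Type*} [MeasurableSpace Ω] {P : Measure Ω} {X : T → Ω → ℝ} {K : T → T → ℝ}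

theorem IsCentredGaussianCov.memLp (hX : IsCentredGaussianCov X K P) (t : T) : MemLp (X t) 2 P :=
  (hX.isGaussian.hasGaussianLaw_eval t).memLp_two

theorem IsCentredGaussianCov.secondMoment (hX : IsCentredGaussianCov X K P) (t : T) :
    ∫ ω, X t ω ^ 2 ∂P = K t t := by
  have := hX.isGaussian.isProbabilityMeasure
  rw [← hX.cov_eq, covariance_eq_sub (hX.memLp t) (hX.memLp t), hX.mean_eq]
  simp [sq]

theorem IsCentredGaussianCov.variance_sub (hX : IsCentredGaussianCov X K P) (r t : T) :
    Var[fun ω => X t ω - X r ω; P] = K t t - 2 * K r t + K r r := by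
  have := hX.isGaussian.isProbabilityMeasure
  have hm := hX.memLp
  have hmeas : AEMeasurable (fun ω => X t ω - X r ω) P :=
    ((hm t).sub (hm r)).aestronglyMeasurable.aemeasurable
  rw [← covariance_self hmeas, covariance_fun_sub_fun_sub (hm t) (hm r) (hm t) (hm r)]
  change cov[X t, X t; P] - cov[X t, X r; P] - cov[X r, X t; P] + cov[X r, X r; P] = _
  rw [covariance_comm (X t) (X r)]
  simp only [hX.cov_eq]
  ring

theorem IsCentredGaussianCov.hasLaw_sub (hX : IsCentredGaussianCov X K P) (r t : T) :
    HasLaw (fun ω => X t ω - X r ω)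
      (gaussianReal 0 (Real.toNNReal (K t t - 2 * K r t + K r r))) P := by
  have := hX.isGaussian.isProbabilityMeasure
  have hm := hX.memLp
  refine ⟨((hm t).sub (hm r)).aestronglyMeasurable.aemeasurable, ?_⟩
  rw [(hX.isGaussian.hasGaussianLaw_fun_sub (s := t) (t := r)).map_eq_gaussianReal,
    hX.variance_sub, integral_sub ((hm t).integrable one_le_two) ((hm r).integrable one_le_two),
    hX.mean_eq, hX.mean_eq, sub_zero]

/-- A centred Gaussian process with continuous paths and covariance `min` is a Wiener process. -/
theorem IsCentredGaussianCov.isWienerOn {τ : ℝ} {X : Set.Icc (0 : ℝ) τ → Ω → ℝ}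
    (hX : IsCentredGaussianCov X (fun r t => min (r : ℝ) t) P)
    (hcont : ∀ ω, Continuous fun t => X t ω) : IsWienerOn τ X P where
  start t ht := by
    have hg := (hX.isGaussian.hasGaussianLaw_eval t)
    have hlaw : HasLaw (X t) (Measure.dirac 0) P := by
      refine ⟨hg.aemeasurable, ?_⟩
      rw [hg.map_eq_gaussianReal, hX.mean_eq, ← covariance_self hg.aemeasurable, hX.cov_eq,
        min_self, ht, Real.toNNReal_zero, gaussianReal_zero_var]
    exact hlaw.ae_eq_of_dirac
  indep := by
    have := hX.isGaussian.isProbabilityMeasure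
    have hm := hX.memLp
    refine fun n t ht =>
      hX.isGaussian.hasGaussianLaw_increments.iIndepFun_of_covariance_eq_zero fun i j hij => ?_
    rw [covariance_fun_sub_fun_sub (hm _) (hm _) (hm _) (hm _)]
    simp only [hX.cov_eq]
    have hmono : ∀ {a b : Fin (n + 1)}, a ≤ b → (t a : ℝ) ≤ t b := fun h => ht h
    rcases lt_or_gt_of_ne hij with h | h
    · have h1 : i.succ ≤ j.castSucc := h
      have h2 : i.castSucc ≤ i.succ := Fin.castSucc_lt_succ.le
      have h3 : j.castSucc ≤ j.succ := Fin.castSucc_lt_succ.le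
      rw [min_eq_left (hmono (h1.trans h3)), min_eq_left (hmono h1),
        min_eq_left (hmono (h2.trans (h1.trans h3))), min_eq_left (hmono (h2.trans h1))]
      ring
    · have h1 : j.succ ≤ i.castSucc := h
      have h2 : i.castSucc ≤ i.succ := Fin.castSucc_lt_succ.le
      have h3 : j.castSucc ≤ j.succ := Fin.castSucc_lt_succ.le
      rw [min_eq_right (hmono (h1.trans h2)), min_eq_right (hmono h1),
        min_eq_right (hmono (h3.trans (h1.trans h2))), min_eq_right (hmono (h3.trans h1))]
      ring
  law r t hrt := by
    convert hX.hasLaw_sub r t using 3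
    rw [min_self, min_self, min_eq_left (show (r : ℝ) ≤ t from hrt)]
    ring
  continuous_paths := ae_of_all _ hcont

end CentredGaussian

/-! ### Linear combinations of independent variables -/

section LinearCombination

variable {ι T Ω : Type*} [MeasurableSpace Ω] {P : Measure Ω} {Z : ι → Ω → ℝ}

theorem covariance_linearCombination (hind : iIndepFun Z P) (hmem : ∀ i, MemLp (Z i) 2 P)
    (J : Finset ι) (a b : ι → ℝ) :
    cov[fun ω => ∑ i ∈ J, Z i ω * a i, fun ω => ∑ i ∈ J, Z i ω * b i; P]
      = ∑ i ∈ J, Var[Z i; P] * (a i * b i) := by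
  have := hind.isProbabilityMeasure
  rw [covariance_fun_sum_fun_sum' (fun i _ => (hmem i).mul_const _)
    (fun i _ => (hmem i).mul_const _)]
  refine Finset.sum_congr rfl fun i hi => ?_
  rw [Finset.sum_eq_single_of_mem i hi]
  · rw [covariance_mul_const_left, covariance_mul_const_right]
    rw [covariance_self (hmem i).aestronglyMeasurable.aemeasurable]
    ring
  · intro j _ hij
    rw [covariance_mul_const_left, covariance_mul_const_right]
    rw [(hind.indepFun hij.symm).covariance_eq_zero (hmem i) (hmem j)]
    ring

theorem integral_linearCombination (hint : ∀ i, Integrable (Z i) P)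
    (hmean : ∀ i, ∫ ω, Z i ω ∂P = 0) (J : Finset ι) (a : ι → ℝ) :
    ∫ ω, ∑ i ∈ J, Z i ω * a i ∂P = 0 := by
  rw [integral_finsetSum _ fun i _ => (hint i).mul_const _]
  simp [integral_mul_const, hmean]

theorem isCentredGaussianCov_linearCombination {v : ι → NNReal} (hind : iIndepFun Z P)
    (hlaw : ∀ i, HasLaw (Z i) (gaussianReal 0 (v i)) P) (J : Finset ι) (f : ι → T → ℝ) :
    IsCentredGaussianCov (fun t ω => ∑ i ∈ J, Z i ω * f i t)
      (fun r t => ∑ i ∈ J, v i * (f i r * f i t)) P where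
  isGaussian := by
    have hJ : HasGaussianLaw (fun ω (i : J) => Z i ω) P :=
      iIndepFun.hasGaussianLaw (fun i : J => (hlaw i).hasGaussianLaw)
        (hind.precomp Subtype.val_injective)
    refine ⟨fun I => ?_⟩
    let L : (J → ℝ) →ₗ[ℝ] (I → ℝ) :=
      { toFun x t := ∑ i, x i * f i t
        map_add' x y := by
          ext t
          simp [add_mul, Finset.sum_add_distrib]
        map_smul' c x := by
          ext t
          simp [Finset.mul_sum, mul_assoc] }
    have e : (fun ω => I.restrict fun t => ∑ i ∈ J, Z i ω * f i t)
        = LinearMap.toContinuousLinearMap L ∘ fun ω (i : J) => Z i ω :=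
      funext fun ω => funext fun t => (Finset.sum_coe_sort J fun i => Z i ω * f i t).symm
    rw [e]
    exact hJ.map _
  mean_eq t := integral_linearCombination (fun i => (hlaw i).hasGaussianLaw.integrable)
    (fun i => by rw [(hlaw i).integral_eq, integral_id_gaussianReal]) J fun i => f i t
  cov_eq r t := by
    rw [covariance_linearCombination hind (fun i => (hlaw i).hasGaussianLaw.memLp_two)]
    refine Finset.sum_congr rfl fun i _ => ?_
    rw [(hlaw i).variance_eq, variance_id_gaussianReal]

end LinearCombination

/-! ### Limits in distribution of Gaussian processes -/

/-- The modulus of the characteristic function at one `u ≠ 0` determines the variance, provided the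
limit does not vanish at `u`; by continuity this holds near 0. -/
theorem exists_tendsto_variance_of_tendsto_gaussianReal {v : ℕ → NNReal}
    {μ : ProbabilityMeasure ℝ}
    (h : Tendsto (β := ProbabilityMeasure ℝ)
      (fun n => ⟨gaussianReal 0 (v n), inferInstance⟩) atTop (𝓝 μ)) :
    ∃ w, Tendsto v atTop (𝓝 w) ∧ (μ : Measure ℝ) = gaussianReal 0 w := by
  have hchar : ∀ u : ℝ, Tendsto (fun n => charFun (gaussianReal 0 (v n)) u) atTop
      (𝓝 (charFun (μ : Measure ℝ) u)) :=
    ProbabilityMeasure.tendsto_iff_tendsto_charFun.1 h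
  obtain ⟨u, hu0, hu⟩ : ∃ u : ℝ, u ≠ 0 ∧ charFun (μ : Measure ℝ) u ≠ 0 := by
    have hc : ContinuousAt (charFun (μ : Measure ℝ)) 0 := continuous_charFun.continuousAt
    have h1 : ∀ᶠ u in 𝓝 (0 : ℝ), charFun (μ : Measure ℝ) u ≠ 0 :=
      hc.eventually_ne (by simp)
    obtain ⟨u, hu, hu0⟩ := ((h1.filter_mono nhdsWithin_le_nhds).and
      (self_mem_nhdsWithin (s := {0}ᶜ) (a := (0 : ℝ)))).exists
    exact ⟨u, hu0, hu⟩
  have hnorm : ∀ n, ‖charFun (gaussianReal 0 (v n)) u‖ = Real.exp (-(v n * u ^ 2 / 2)) := by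
    intro n
    rw [charFun_gaussianReal, Complex.norm_exp]
    congr 1
    have : ((u : ℂ) * (0 : ℝ) * Complex.I - (v n : ℂ) * u ^ 2 / 2)
        = ((-(v n * u ^ 2 / 2) : ℝ) : ℂ) := by
      push_cast
      ring
    rw [this, Complex.ofReal_re]
  have hlog : Tendsto (fun n => -(v n * u ^ 2 / 2)) atTop
      (𝓝 (Real.log ‖charFun (μ : Measure ℝ) u‖)) := by
    have := ((hchar u).norm).log (norm_ne_zero_iff.2 hu)
    simpa only [hnorm, Real.log_exp] using this
  have hv : Tendsto (fun n => (v n : ℝ)) atTop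
      (𝓝 (Real.log ‖charFun (μ : Measure ℝ) u‖ * (-2 / u ^ 2))) := by
    refine (hlog.mul_const (-2 / u ^ 2)).congr fun n => ?_
    field_simp
  have hnn : 0 ≤ Real.log ‖charFun (μ : Measure ℝ) u‖ * (-2 / u ^ 2) :=
    ge_of_tendsto' hv fun n => (v n).2
  lift Real.log ‖charFun (μ : Measure ℝ) u‖ * (-2 / u ^ 2) to NNReal using hnn with w hw
  refine ⟨w, NNReal.tendsto_coe.1 hv, Measure.ext_of_charFun (funext fun x => ?_)⟩
  refine tendsto_nhds_unique (hchar x) ?_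
  simp_rw [charFun_gaussianReal]
  refine (Complex.continuous_exp.tendsto _).comp (tendsto_const_nhds.sub ?_)
  exact (((Complex.continuous_ofReal.tendsto _).comp hv).mul_const _).div_const _

section GaussianLimit

variable {Ω : ℕ → Type*} [∀ n, MeasurableSpace (Ω n)] {P : (n : ℕ) → Measure (Ω n)}
  [∀ n, IsProbabilityMeasure (P n)] {Ω' : Type*} [MeasurableSpace Ω'] {Q : Measure Ω'}
  [IsProbabilityMeasure Q]

theorem exists_tendsto_variance_of_tendstoInDistribution {X : (n : ℕ) → Ω n → ℝ} {Y : Ω' → ℝ}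
    (hX : ∀ n, HasGaussianLaw (X n) (P n)) (hmean : ∀ n, ∫ ω, X n ω ∂(P n) = 0)
    (h : TendstoInDistribution X atTop Y P Q) :
    HasGaussianLaw Y Q ∧ ∫ ω, Y ω ∂Q = 0 ∧
      Tendsto (fun n => Var[X n; P n]) atTop (𝓝 Var[Y; Q]) := by
  have ht := h.tendsto
  have heq : ∀ n, (P n).map (X n) = gaussianReal 0 (Var[X n; P n].toNNReal) := fun n => by
    rw [(hX n).map_eq_gaussianReal, hmean]
  simp_rw [heq] at ht
  obtain ⟨w, hw, hY⟩ := exists_tendsto_variance_of_tendsto_gaussianReal ht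
  have hlaw : HasLaw Y (gaussianReal 0 w) Q := ⟨h.aemeasurable_limit, hY⟩
  refine ⟨hlaw.hasGaussianLaw, by rw [hlaw.integral_eq, integral_id_gaussianReal], ?_⟩
  rw [hlaw.variance_eq, variance_id_gaussianReal]
  refine (NNReal.tendsto_coe.2 hw).congr fun n => ?_
  rw [Real.coe_toNNReal _ (variance_nonneg _ _)]

/-- Cramér–Wold: a linear functional of finitely many values is continuous on `C[0,1]`, so the
one-dimensional case applies to it. -/
theorem IsCentredGaussianCov.of_tendstoInDistribution {X : (n : ℕ) → Ω n → C(unitInterval, ℝ)}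
    {Y : Ω' → C(unitInterval, ℝ)} {K : ℕ → unitInterval → unitInterval → ℝ}
    (hX : ∀ n, IsCentredGaussianCov (fun t ω => X n ω t) (K n) (P n))
    (h : TendstoInDistribution X atTop Y P Q) :
    ∃ C, IsCentredGaussianCov (fun t ω => Y ω t) C Q ∧
      ∀ r t, Tendsto (fun n => K n r t) atTop (𝓝 (C r t)) := by
  have hfun : ∀ (I : Finset unitInterval) (L : (I → ℝ) →L[ℝ] ℝ),
      HasGaussianLaw (fun ω => L (fun i => Y ω i)) Q ∧ ∫ ω, L (fun i => Y ω i) ∂Q = 0 ∧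
      Tendsto (fun n => Var[fun ω => L (fun i => X n ω i); P n]) atTop
        (𝓝 Var[fun ω => L (fun i => Y ω i); Q]) := by
    intro I L
    refine exists_tendsto_variance_of_tendstoInDistribution
      (X := fun n ω => L (fun i => X n ω i)) (Y := fun ω => L (fun i => Y ω i))
      (fun n => ((hX n).isGaussian.hasGaussianLaw I).map L) (fun n => ?_)
      (h.continuous_comp (g := fun f : C(unitInterval, ℝ) => L (fun i : I => f i)) (by fun_prop))
    have hG := (hX n).isGaussian.hasGaussianLaw I
    rw [ContinuousLinearMap.integral_comp_comm L (φ := fun ω (i : I) => X n ω i) hG.integrable]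
    convert map_zero L
    ext i
    rw [eval_integral fun i : I => ((hX n).memLp i).integrable one_le_two]
    exact (hX n).mean_eq i
  have hgauss : IsGaussianProcess (fun t ω => Y ω t) Q := by
    refine ⟨fun I => ⟨isGaussian_of_isGaussian_map fun L => ?_⟩⟩
    have hmeas : AEMeasurable (fun ω => I.restrict fun t => Y ω t) Q := by
      have : Measurable fun (f : C(unitInterval, ℝ)) (i : I) => f i :=
        Continuous.measurable (by fun_prop)
      exact this.comp_aemeasurable h.aemeasurable_limit
    rw [AEMeasurable.map_map_of_aemeasurable (by fun_prop) hmeas]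
    exact (hfun I L).1.isGaussian_map
  have hmem : ∀ t, MemLp (fun ω => Y ω t) 2 Q := fun t => (hgauss.hasGaussianLaw_eval t).memLp_two
  refine ⟨fun r t => cov[fun ω => Y ω r, fun ω => Y ω t; Q], ⟨hgauss, fun t => ?_, fun _ _ => rfl⟩,
    fun r t => ?_⟩
  · exact (hfun {t} (ContinuousLinearMap.proj ⟨t, by simp⟩)).2.1
  · have e1 := (hfun {r} (ContinuousLinearMap.proj ⟨r, by simp⟩)).2.2
    have e2 := (hfun {t} (ContinuousLinearMap.proj ⟨t, by simp⟩)).2.2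
    -- Polarization: the covariance is recovered from the variances of the two values and of their
    -- sum.
    have e3 := (hfun {r, t} (ContinuousLinearMap.proj ⟨r, by simp⟩
      + ContinuousLinearMap.proj ⟨t, by simp⟩)).2.2
    simp only [ContinuousLinearMap.proj_apply, _root_.add_apply] at e1 e2 e3
    have hlim := ((e3.sub e1).sub e2).div_const 2
    convert hlim using 1
    · ext n
      have hm := (hX n).memLp
      rw [variance_fun_add (hm r) (hm t), ← (hX n).cov_eq]
      ring
    · rw [variance_fun_add (hmem r) (hmem t)]
      ring_nf

end GaussianLimit

/-! ### Small mesh -/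

section Mesh

variable {m : ℕ → ℕ} {s : (n : ℕ) → Fin (m n) → ℝ}

theorem tendsto_polygonalKernel_of_mesh (hs : ∀ n j, 0 < s n j) (hsum : ∀ n, ∑ j, s n j ^ 2 = 1)
    {δ : ℕ → ℝ} (hδ : Tendsto δ atTop (𝓝 0)) (hsδ : ∀ n j, s n j ^ 2 ≤ δ n) (r t : unitInterval) :
    Tendsto (fun n => polygonalKernel (s n) r t) atTop (𝓝 (min (r : ℝ) t)) := by
  wlog hrt : r ≤ t generalizing r t
  · simp_rw [fun n => polygonalKernel_comm (s n) r t, min_comm (r : ℝ)]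
    exact this t r (le_of_not_ge hrt)
  have hb : Tendsto (fun n => bridgeKernel (s n) r t) atTop (𝓝 0) := by
    refine squeeze_zero (fun n => bridgeKernel_nonneg _ _ _) (fun n => ?_) hδ
    obtain ⟨j, hj⟩ := bridgeKernel_diag_le (hs n) (hsum n) r.2.1 r.2.2
    exact ((bridgeKernel_le_diag (s n) le_rfl hrt).trans hj).trans (hsδ n j)
  rw [min_eq_left (show (r : ℝ) ≤ t from hrt)]
  refine (((tendsto_const_nhds (x := (r : ℝ))).sub hb).congr fun n => ?_).trans (by simp)
  linarith [polygonalKernel_add_bridgeKernel (t := (t : ℝ)) (hs n) (hsum n) r.2.1 r.2.2]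

end Mesh

/-! ### The Lévy–Ciesielski construction of the Wiener process -/

section LevyCiesielski

/-- The integral from `0` of the indicator of the `k`-th dyadic segment of level `n`. -/
noncomputable def dyadicRamp (n k : ℕ) : C(unitInterval, ℝ) :=
  minFunction (((k : ℝ) + 1) / 2 ^ n) - minFunction ((k : ℝ) / 2 ^ n)

theorem dyadicRamp_apply (n k : ℕ) (t : unitInterval) :
    dyadicRamp n k t = min (t : ℝ) (((k : ℝ) + 1) / 2 ^ n) - min (t : ℝ) ((k : ℝ) / 2 ^ n) := rfl

theorem dyadicRamp_split (n k : ℕ) (t : unitInterval) :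
    dyadicRamp n k t = dyadicRamp (n + 1) (2 * k) t + dyadicRamp (n + 1) (2 * k + 1) t := by
  simp only [dyadicRamp_apply]
  have h1 : ((2 * k : ℕ) : ℝ) / 2 ^ (n + 1) = k / 2 ^ n := by
    push_cast
    field_simp
    ring
  have h2 : (((2 * k : ℕ) : ℝ) + 1) / 2 ^ (n + 1) = ((2 * k + 1 : ℕ) : ℝ) / 2 ^ (n + 1) := by
    push_cast
    ring
  have h3 : (((2 * k + 1 : ℕ) : ℝ) + 1) / 2 ^ (n + 1) = ((k : ℝ) + 1) / 2 ^ n := by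
    push_cast
    field_simp
    ring
  rw [h1, h2, h3]
  ring

/-- The Faber–Schauder functions, normalised as integrals of the Haar functions. -/
noncomputable def faberSchauder : ℕ → ℕ → C(unitInterval, ℝ)
  | 0, k => dyadicRamp 0 k
  | n + 1, k => √(2 ^ n) • (dyadicRamp (n + 1) (2 * k) - dyadicRamp (n + 1) (2 * k + 1))

/-- The covariance function of the Wiener process interpolated at the dyadic points. -/
noncomputable def dyadicKernel (n : ℕ) (r t : unitInterval) : ℝ :=
  ∑ k ∈ Finset.range (2 ^ n), 2 ^ n * (dyadicRamp n k r * dyadicRamp n k t)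

theorem sum_range_two_mul (f : ℕ → ℝ) (M : ℕ) :
    ∑ i ∈ Finset.range (2 * M), f i = ∑ i ∈ Finset.range M, (f (2 * i) + f (2 * i + 1)) := by
  induction M with
  | zero => simp
  | succ M ih =>
    rw [Finset.sum_range_succ, ← ih, show 2 * (M + 1) = 2 * M + 1 + 1 by ring,
      Finset.sum_range_succ, Finset.sum_range_succ]
    ring

/-- Halving a segment splits `d = d' + d''` and `e = e' + e''`, and `2 (d'e' + d''e'') = (d' +
d'')(e' + e'') + (d' - d'')(e' - e'')`. -/
theorem dyadicKernel_succ (n : ℕ) (r t : unitInterval) :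
    dyadicKernel (n + 1) r t = dyadicKernel n r t
      + ∑ k ∈ Finset.range (2 ^ n), faberSchauder (n + 1) k r * faberSchauder (n + 1) k t := by
  rw [dyadicKernel, dyadicKernel, pow_succ', sum_range_two_mul, ← Finset.sum_add_distrib]
  refine Finset.sum_congr rfl fun k _ => ?_
  have h : √(2 ^ n) * √(2 ^ n) = (2 : ℝ) ^ n := Real.mul_self_sqrt (by positivity)
  simp only [faberSchauder, ContinuousMap.smul_apply, ContinuousMap.sub_apply, smul_eq_mul,
    dyadicRamp_split n k]
  rw [mul_mul_mul_comm, h]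
  ring

/-- The index set of the Faber–Schauder functions of levels at most `N`. -/
def schauderIndex (N : ℕ) : Finset ((_ : ℕ) × ℕ) :=
  (Finset.range (N + 1)).sigma fun n => Finset.range (2 ^ (n - 1))

theorem sum_faberSchauder_mul (N : ℕ) (r t : unitInterval) :
    ∑ p ∈ schauderIndex N, faberSchauder p.1 p.2 r * faberSchauder p.1 p.2 t
      = dyadicKernel N r t := by
  rw [schauderIndex, Finset.sum_sigma]
  induction N with
  -- Truncated subtraction gives `2 ^ (0 - 1) = 1`: level 0 consists of a single function.
  | zero => simp [dyadicKernel, faberSchauder]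
  | succ N ih => rw [Finset.sum_range_succ, ih, dyadicKernel_succ, Nat.add_sub_cancel]

/-- This is the polygonal kernel of `2 ^ n` equal steps, whose mesh tends to 0. -/
theorem tendsto_dyadicKernel (r t : unitInterval) :
    Tendsto (fun n => dyadicKernel n r t) atTop (𝓝 (min (r : ℝ) t)) := by
  have hsq : ∀ n : ℕ, √(((2 : ℝ) ^ n)⁻¹) ^ 2 = (2 ^ n)⁻¹ := fun n => Real.sq_sqrt (by positivity)
  have hs : ∀ (n : ℕ) (j : Fin (2 ^ n)), 0 < (fun _ : Fin (2 ^ n) => √(((2 : ℝ) ^ n)⁻¹)) j :=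
    fun n j => by positivity
  have hknot : ∀ (n k : ℕ), k ≤ 2 ^ n →
      knot (fun _ : Fin (2 ^ n) => √(((2 : ℝ) ^ n)⁻¹)) k = k / 2 ^ n := by
    intro n k
    induction k with
    | zero => simp [knot_zero]
    | succ k ih =>
      intro hk
      rw [knot_succ _ ⟨k, hk⟩, ih (by omega), hsq]
      push_cast
      ring
  refine (tendsto_polygonalKernel_of_mesh hs (fun n => ?_)
    (tendsto_inv_atTop_zero.comp (tendsto_pow_atTop_atTop_of_one_lt (one_lt_two (α := ℝ))))
    (fun n j => (hsq n).le) r t).congr fun n => ?_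
  · rw [Finset.sum_const, hsq, Finset.card_univ, Fintype.card_fin, nsmul_eq_mul]
    push_cast
    exact mul_inv_cancel₀ (by positivity)
  · have hramp : ∀ (j : Fin (2 ^ n)) (x : unitInterval),
        ramp (fun _ : Fin (2 ^ n) => √(((2 : ℝ) ^ n)⁻¹)) j x = 2 ^ n * dyadicRamp n j x := by
      intro j x
      have h := sq_mul_ramp (hs n) j x
      rw [hknot n _ j.2, hknot n _ j.2.le, hsq, min_comm _ (x : ℝ), min_comm _ (x : ℝ),
        inv_mul_eq_iff_eq_mul₀ (by positivity)] at h
      rw [h, dyadicRamp_apply]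
      push_cast
      rfl
    rw [polygonalKernel, dyadicKernel, ← Fin.sum_univ_eq_sum_range
      (fun k => (2 : ℝ) ^ n * (dyadicRamp n k r * dyadicRamp n k t))]
    refine Finset.sum_congr rfl fun j _ => ?_
    rw [hramp, hramp, hsq]
    field_simp

/-- The functions of one level have essentially disjoint supports, so at most one of them
contributes at `t`. -/
theorem faberSchauder_eq_zero {n k : ℕ} {t : unitInterval} (hk : k ≠ ⌊(t : ℝ) * 2 ^ n⌋₊) :
    faberSchauder (n + 1) k t = 0 := by
  have ht : (0 : ℝ) ≤ t * 2 ^ n := mul_nonneg t.2.1 (by positivity)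
  have hpow : (0 : ℝ) < 2 ^ n := by positivity
  have e : (2 : ℝ) ^ (n + 1) = 2 ^ n * 2 := pow_succ _ _
  simp only [faberSchauder, ContinuousMap.smul_apply, ContinuousMap.sub_apply, smul_eq_mul,
    dyadicRamp_apply]
  rcases lt_or_gt_of_ne hk with h | h
  · have h1 : ((k : ℝ) + 1) / 2 ^ n ≤ t := by
      rw [div_le_iff₀ hpow]
      exact_mod_cast (Nat.le_floor_iff ht).1 h
    have h2 : ((k : ℝ) + 1) ≤ t * 2 ^ n := (div_le_iff₀ hpow).1 h1
    rw [min_eq_right, min_eq_right, min_eq_right, min_eq_right]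
    · push_cast
      ring
    all_goals
      rw [div_le_iff₀ (by positivity), e]
      push_cast
      linarith
  · have h2 : (t : ℝ) * 2 ^ n < k := (Nat.floor_lt ht).1 h
    rw [min_eq_left, min_eq_left, min_eq_left, min_eq_left]
    · ring
    all_goals
      rw [le_div_iff₀ (by positivity), e]
      push_cast
      linarith

theorem dyadicRamp_mem_Icc (n k : ℕ) (t : unitInterval) :
    dyadicRamp n k t ∈ Set.Icc (0 : ℝ) (2 ^ n)⁻¹ := by
  have h : ((k : ℝ) + 1) / 2 ^ n = k / 2 ^ n + (2 ^ n)⁻¹ := by ring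
  have hp : (0 : ℝ) < (2 ^ n)⁻¹ := by positivity
  rw [dyadicRamp_apply, h]
  constructor
  · exact sub_nonneg.2 (min_le_min le_rfl (by linarith))
  · rcases le_total (t : ℝ) (k / 2 ^ n) with h1 | h1
    · rw [min_eq_left h1, min_eq_left (by linarith)]
      linarith
    · rw [min_eq_right h1]
      linarith [min_le_right (t : ℝ) (k / 2 ^ n + (2 ^ n)⁻¹)]

theorem faberSchauder_pow_four_le (n k : ℕ) (t : unitInterval) :
    faberSchauder (n + 1) k t ^ 4 ≤ (4 ^ n)⁻¹ := by
  obtain ⟨h1, h2⟩ := dyadicRamp_mem_Icc (n + 1) (2 * k) t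
  obtain ⟨h3, h4⟩ := dyadicRamp_mem_Icc (n + 1) (2 * k + 1) t
  have hle : ((2 : ℝ) ^ (n + 1))⁻¹ ≤ (2 ^ n)⁻¹ := by
    gcongr
    · norm_num
    · omega
  simp only [faberSchauder, ContinuousMap.smul_apply, ContinuousMap.sub_apply, smul_eq_mul]
  set d := dyadicRamp (n + 1) (2 * k) t - dyadicRamp (n + 1) (2 * k + 1) t
  have hd : |d| ≤ (2 ^ n)⁻¹ := abs_le.2 ⟨by linarith, by linarith⟩
  have hsq : √((2 : ℝ) ^ n) ^ 2 = 2 ^ n := Real.sq_sqrt (by positivity)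
  calc (√(2 ^ n) * d) ^ 4 = (√(2 ^ n) ^ 2) ^ 2 * |d| ^ 4 := by
        rw [Even.pow_abs (by decide)]
        ring
    _ ≤ (2 ^ n) ^ 2 * ((2 ^ n)⁻¹) ^ 4 := by
        rw [hsq]
        gcongr
    _ = (4 ^ n)⁻¹ := by
        rw [show (4 : ℝ) = 2 * 2 by norm_num, mul_pow]
        field_simp

theorem le_add_pow_four_div {x q : ℝ} (hq : 0 < q) : x ≤ q + x ^ 4 / q ^ 3 := by
  have hx4 : 0 ≤ x ^ 4 / q ^ 3 := by positivity
  rcases le_total x q with h | h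
  · linarith
  · have hx : 0 < x := hq.trans_le h
    have : x ≤ x ^ 4 / q ^ 3 := by
      rw [le_div_iff₀ (by positivity)]
      calc x * q ^ 3 ≤ x * x ^ 3 := by gcongr
        _ = x ^ 4 := by ring
    linarith

/-- Disjoint supports bound the fourth power of the sup by `4^{-n} ∑ z_k⁴`; splitting at the
threshold `q = (4/5)^n` gives the rest. The ratio 4/5 is below 1, yet its cube exceeds 1/2, as
needed for summable expectations. -/
theorem norm_schauder_level_le (n : ℕ) (z : ℕ → ℝ) :
    ‖∑ k ∈ Finset.range (2 ^ n), z k • faberSchauder (n + 1) k‖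
      ≤ (4 / 5) ^ n + (125 / 256) ^ n * ∑ k ∈ Finset.range (2 ^ n), z k ^ 4 := by
  have hz : 0 ≤ ∑ k ∈ Finset.range (2 ^ n), z k ^ 4 :=
    Finset.sum_nonneg fun k _ => by positivity
  have hpow : ∀ t : unitInterval,
      (∑ k ∈ Finset.range (2 ^ n), z k * faberSchauder (n + 1) k t) ^ 4
        ≤ (4 ^ n)⁻¹ * ∑ k ∈ Finset.range (2 ^ n), z k ^ 4 := by
    intro t
    by_cases hk : ⌊(t : ℝ) * 2 ^ n⌋₊ ∈ Finset.range (2 ^ n)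
    · rw [Finset.sum_eq_single_of_mem _ hk fun k _ hne => by
        rw [faberSchauder_eq_zero hne, mul_zero], mul_pow, mul_comm]
      exact mul_le_mul (faberSchauder_pow_four_le _ _ _)
        (Finset.single_le_sum (f := fun k => z k ^ 4) (fun k _ => by positivity) hk)
        (by positivity) (by positivity)
    -- The index leaves the range only at `t = 1`, where every summand vanishes.
    · rw [Finset.sum_eq_zero fun k hk' => by
        rw [faberSchauder_eq_zero (by rintro rfl; exact hk hk'), mul_zero]]
      simpa using by positivity
  have hq : (0 : ℝ) < (4 / 5) ^ n := by positivity
  have hc : ((125 : ℝ) / 256) ^ n = (4 ^ n)⁻¹ / ((4 / 5) ^ n) ^ 3 := by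
    rw [← pow_mul, mul_comm n 3, pow_mul, ← inv_pow, ← div_pow]
    norm_num
  refine (ContinuousMap.norm_le _ (by positivity)).2 fun t => ?_
  simp only [ContinuousMap.sum_apply, ContinuousMap.smul_apply, smul_eq_mul]
  refine (le_add_pow_four_div hq).trans ?_
  rw [hc, div_mul_eq_mul_div]
  gcongr
  rw [Real.norm_eq_abs, Even.pow_abs (by decide)]
  exact hpow t

theorem ae_summable_of_summable_integral {Ω : Type*} [MeasurableSpace Ω] {P : Measure Ω}
    {U : ℕ → Ω → ℝ} (hnn : ∀ n ω, 0 ≤ U n ω) (hint : ∀ n, Integrable (U n) P)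
    (hsum : Summable fun n => ∫ ω, U n ω ∂P) : ∀ᵐ ω ∂P, Summable fun n => U n ω := by
  have hmeas : ∀ n, AEMeasurable (fun ω => ENNReal.ofReal (U n ω)) P :=
    fun n => (hint n).aemeasurable.ennreal_ofReal
  have hfin : ∫⁻ ω, ∑' n, ENNReal.ofReal (U n ω) ∂P ≠ ⊤ := by
    rw [lintegral_tsum hmeas]
    simp_rw [fun n => (ofReal_integral_eq_lintegral_ofReal (hint n) (ae_of_all _ (hnn n))).symm]
    exact hsum.tsum_ofReal_ne_top
  filter_upwards [ae_lt_top' (AEMeasurable.tsum hmeas) hfin] with ω hω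
  exact (ENNReal.summable_toReal hω.ne).congr fun n => ENNReal.toReal_ofReal (hnn n ω)

/-- The partial sums of the Lévy–Ciesielski series. -/
noncomputable def levySum (N : ℕ) (z : (_ : ℕ) × ℕ → ℝ) : C(unitInterval, ℝ) :=
  ∑ p ∈ schauderIndex N, z p • faberSchauder p.1 p.2

theorem measurable_levySum (N : ℕ) : Measurable (levySum N) := by
  have : Continuous (levySum N) := by
    unfold levySum
    fun_prop
  exact this.measurable

/-- Level `n + 1` has `2 ^ n` coefficients with equal fourth moments, so the expected bounds are
multiples of `(125/128)^n` and add up. Independence is not needed here. -/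
theorem ae_exists_tendsto_levySum {Ω : Type*} [MeasurableSpace Ω] {P : Measure Ω}
    {Z : (_ : ℕ) × ℕ → Ω → ℝ} (hlaw : ∀ p, HasLaw (Z p) (gaussianReal 0 1) P) :
    ∀ᵐ ω ∂P, ∃ w, Tendsto (fun N => levySum N fun p => Z p ω) atTop (𝓝 w) := by
  have hmem : MemLp (id : ℝ → ℝ) (4 : ℕ) (gaussianReal 0 1) :=
    memLp_id_gaussianReal _
  have hint1 : Integrable (fun x : ℝ => x ^ 4) (gaussianReal 0 1) := by
    simpa [Even.pow_abs (show Even 4 by decide)] using hmem.integrable_norm_pow (by norm_num)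
  have hint : ∀ p, Integrable (fun ω => Z p ω ^ 4) P := fun p => by
    have h := hint1
    rw [← (hlaw p).map_eq] at h
    exact h.comp_aemeasurable (hlaw p).aemeasurable
  have hval : ∀ p, ∫ ω, Z p ω ^ 4 ∂P = ∫ x, x ^ 4 ∂gaussianReal 0 1 := fun p =>
    (hlaw p).integral_comp (f := fun x => x ^ 4) hint1.aestronglyMeasurable
  have hae := ae_summable_of_summable_integral (P := P)
    (U := fun n ω => (125 / 256) ^ n * ∑ k ∈ Finset.range (2 ^ n), Z ⟨n + 1, k⟩ ω ^ 4)
    (fun n ω => mul_nonneg (by positivity) (Finset.sum_nonneg fun k _ => by positivity))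
    (fun n => (integrable_finsetSum _ fun k _ => hint _).const_mul _) (by
      simp_rw [integral_const_mul,
        fun n => integral_finsetSum (Finset.range (2 ^ n)) fun k _ => hint ⟨n + 1, k⟩, hval]
      simp only [Finset.sum_const, Finset.card_range, nsmul_eq_mul, ← mul_assoc]
      push_cast
      simp only [← mul_pow]
      exact (summable_geometric_of_lt_one (by norm_num) (by norm_num)).mul_right _)
  filter_upwards [hae] with ω hω
  have hs : Summable fun n => ∑ k ∈ Finset.range (2 ^ (n - 1)), Z ⟨n, k⟩ ω • faberSchauder n k := by
    refine (summable_nat_add_iff 1).1 (Summable.of_norm_bounded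
      ((summable_geometric_of_lt_one (r := (4 / 5 : ℝ)) (by norm_num) (by norm_num)).add hω)
      fun n => ?_)
    exact norm_schauder_level_le n fun k => Z ⟨n + 1, k⟩ ω
  refine ⟨_, ((tendsto_add_atTop_iff_nat 1).2 hs.hasSum.tendsto_sum_nat).congr fun N => ?_⟩
  rw [levySum, schauderIndex, Finset.sum_sigma]

/-- Existence of a Wiener process with paths in `C[0,1]`. -/
theorem exists_wiener : ∃ (Ω : Type) (_ : MeasurableSpace Ω) (P : Measure Ω)
    (_ : IsProbabilityMeasure P) (W : Ω → C(unitInterval, ℝ)), AEMeasurable W P ∧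
      IsCentredGaussianCov (fun t ω => W ω t) (fun r t => min (r : ℝ) t) P := by
  classical
  let P : Measure ((_ : ℕ) × ℕ → ℝ) := Measure.infinitePi fun _ => gaussianReal 0 1
  have hind : iIndepFun (fun p (z : (_ : ℕ) × ℕ → ℝ) => z p) P :=
    iIndepFun_infinitePi (X := fun _ x => x) fun _ => measurable_id
  have hlaw : ∀ p, HasLaw (fun z : (_ : ℕ) × ℕ → ℝ => z p) (gaussianReal 0 1) P := fun p =>
    ⟨(measurable_pi_apply p).aemeasurable, Measure.infinitePi_map_eval _ p⟩
  have hconv := ae_exists_tendsto_levySum hlaw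
  -- The value 0 is taken only on the null set of divergence.
  let W : ((_ : ℕ) × ℕ → ℝ) → C(unitInterval, ℝ) := fun z =>
    if h : ∃ w, Tendsto (fun N => levySum N z) atTop (𝓝 w) then h.choose else 0
  have hW : ∀ᵐ z ∂P, Tendsto (fun N => levySum N z) atTop (𝓝 (W z)) := by
    filter_upwards [hconv] with z hz
    simp only [W, dif_pos hz]
    exact hz.choose_spec
  have hm : ∀ N, AEMeasurable (levySum N) P := fun N => (measurable_levySum N).aemeasurable
  have hWm : AEMeasurable W P := aemeasurable_of_tendsto_metrizable_ae atTop hm hW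
  have hG : ∀ N, IsCentredGaussianCov (fun t z => levySum N z t) (dyadicKernel N) P := fun N => by
    have := isCentredGaussianCov_linearCombination hind hlaw (schauderIndex N)
      fun p (t : unitInterval) => faberSchauder p.1 p.2 t
    convert this using 1
    · ext t z
      simp [levySum, ContinuousMap.sum_apply]
    · ext r t
      simp [← sum_faberSchauder_mul]
  obtain ⟨C, hC, hlim⟩ := IsCentredGaussianCov.of_tendstoInDistribution hG
    (tendstoInDistribution_of_ae_tendsto hm hWm hW)
  have hCmin : C = fun r t : unitInterval => min (r : ℝ) t := by
    ext r t
    exact tendsto_nhds_unique (hlim r t) (tendsto_dyadicKernel r t)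
  exact ⟨_, inferInstance, P, inferInstance, W, hWm, hCmin ▸ hC⟩

end LevyCiesielski

/-! ### Polygonal processes -/

section PolygonalProcess

variable {Ω : Type*} [MeasurableSpace Ω] {P : Measure Ω} {m : ℕ} {s : Fin m → ℝ}

theorem continuous_polygonal (s : Fin m → ℝ) : Continuous (polygonal s) := by
  let L : (Fin m → ℝ) →ₗ[ℝ] C(unitInterval, ℝ) :=
    { toFun := polygonal s
      map_add' x y := by
        ext t
        simp [polygonal_apply, add_mul, Finset.sum_add_distrib]
      map_smul' c x := by
        ext t
        simp [polygonal_apply, Finset.mul_sum, mul_assoc] }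
  exact L.continuous_of_finiteDimensional

theorem aemeasurable_polygonalProcess {x : Fin m → Ω → ℝ} (hx : ∀ j, AEMeasurable (x j) P) :
    AEMeasurable (polygonalProcess s x) P :=
  (continuous_polygonal s).measurable.comp_aemeasurable (aemeasurable_pi_lambda _ hx)

theorem isCentredGaussianCov_polygonalProcess {η : Fin m → Ω → ℝ} (hind : iIndepFun η P)
    (hlaw : ∀ j, HasLaw (η j) (gaussianReal 0 (Real.toNNReal (s j ^ 2))) P) :
    IsCentredGaussianCov (fun (t : unitInterval) ω => polygonalProcess s η ω t)
      (fun r t => polygonalKernel s r t) P := by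
  have h := isCentredGaussianCov_linearCombination hind hlaw Finset.univ
    fun j (t : unitInterval) => ramp s j t
  simp only [Real.coe_toNNReal _ (sq_nonneg _)] at h
  exact h

/-- Only independence and the first two moments matter, so `ξ` gives the same second moments as the
Gaussian array. -/
theorem rootSecondMoment_polygonalProcess [IsProbabilityMeasure P] {ξ : Fin m → Ω → ℝ}
    (hind : iIndepFun ξ P) (hmem : ∀ j, MemLp (ξ j) 2 P) (hmean : ∀ j, ∫ ω, ξ j ω ∂P = 0)
    (hvar : ∀ j, ∫ ω, ξ j ω ^ 2 ∂P = s j ^ 2) (t : unitInterval) :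
    rootSecondMoment (polygonalProcess s ξ) P t = √(polygonalKernel s t t) := by
  rw [rootSecondMoment]
  congr 1
  have hL : MemLp (fun ω => ∑ j, ξ j ω * ramp s j t) 2 P :=
    memLp_finsetSum _ fun j _ => (hmem j).mul_const _
  have h0 := integral_linearCombination (fun j => (hmem j).integrable one_le_two) hmean
    Finset.univ fun j => ramp s j t
  have hcov := covariance_linearCombination hind hmem Finset.univ (fun j => ramp s j t)
    fun j => ramp s j t
  rw [covariance_eq_sub hL hL, h0, mul_zero, sub_zero] at hcov
  have hv : ∀ j, Var[ξ j; P] = s j ^ 2 := fun j => by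
    rw [variance_of_integral_eq_zero (hmem j).aestronglyMeasurable.aemeasurable (hmean j), hvar]
  simp only [hv] at hcov
  rw [polygonalKernel, ← hcov]
  refine integral_congr_ae (ae_of_all _ fun ω => ?_)
  exact sq _

theorem continuous_polygonalInterp (hsum : ∑ j, s j ^ 2 = 1) :
    Continuous (polygonalInterp s hsum) :=
  (continuous_polygonal s).comp (by fun_prop)

/-- The interpolation of a Wiener process at the knots has the law of the polygonal process with
Gaussian increments. -/
theorem map_polygonalInterp_wiener {Ω' : Type*} [MeasurableSpace Ω'] {Q : Measure Ω'}
    (hsum : ∑ j, s j ^ 2 = 1) {W : Ω → C(unitInterval, ℝ)}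
    (hW : IsCentredGaussianCov (fun t ω => W ω t) (fun r t => min (r : ℝ) t) P)
    {η : Fin m → Ω' → ℝ} (hind : iIndepFun η Q)
    (hlaw : ∀ j, HasLaw (η j) (gaussianReal 0 (Real.toNNReal (s j ^ 2))) Q) :
    P.map (fun ω => polygonalInterp s hsum (W ω)) = Q.map (polygonalProcess s η) := by
  have hwien : IsWienerOn 1 (fun (t : Set.Icc (0 : ℝ) 1) ω => W ω t) P :=
    hW.isWienerOn fun ω => (W ω).continuous
  let inc : Fin m → Ω → ℝ := fun j ω =>
    W ω (knotPoint s hsum ((j : ℕ) + 1)) - W ω (knotPoint s hsum j)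
  have hinc_ind : iIndepFun inc P := hwien.indep m (fun k => knotPoint s hsum k)
    fun a b hab => knot_monotone s hab
  have hinc_law : ∀ j, HasLaw (inc j) (gaussianReal 0 (Real.toNNReal (s j ^ 2))) P := fun j => by
    have h := hwien.law (knotPoint s hsum j) (knotPoint s hsum ((j : ℕ) + 1))
      (knot_monotone s (Nat.le_succ _))
    have e : ((knotPoint s hsum ((j : ℕ) + 1) : unitInterval) : ℝ) - knotPoint s hsum j
        = s j ^ 2 := sub_eq_of_eq_add' (knot_succ s j)
    rwa [e] at h
  -- Both vectors have independent coordinates with the same marginals, hence the same product law.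
  have hvec : P.map (fun ω j => inc j ω) = Q.map (fun ω j => η j ω) := by
    rw [hinc_ind.map_fun_eq_pi_map fun j => (hinc_law j).aemeasurable,
      hind.map_fun_eq_pi_map fun j => (hlaw j).aemeasurable]
    simp only [fun j => (hinc_law j).map_eq, fun j => (hlaw j).map_eq]
  have hp := (continuous_polygonal s).measurable
  calc P.map (fun ω => polygonalInterp s hsum (W ω))
      = (P.map fun ω j => inc j ω).map (polygonal s) := by
        rw [AEMeasurable.map_map_of_aemeasurable hp.aemeasurable
          (aemeasurable_pi_lambda _ fun j => (hinc_law j).aemeasurable)]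
        rfl
    _ = Q.map (polygonalProcess s η) := by
        rw [hvec, AEMeasurable.map_map_of_aemeasurable hp.aemeasurable
          (aemeasurable_pi_lambda _ fun j => (hlaw j).aemeasurable)]
        rfl

end PolygonalProcess

/-! ### Existence and structure of the limit process -/

section Limit

variable {m : ℕ → ℕ} {s : (n : ℕ) → Fin (m n) → ℝ} {Ωη : ℕ → Type*} [∀ n, MeasurableSpace (Ωη n)]
  {Pη : (n : ℕ) → Measure (Ωη n)} [∀ n, IsProbabilityMeasure (Pη n)]
  {η : (n : ℕ) → Fin (m n) → Ωη n → ℝ}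

theorem exists_limit_of_tendsto_polygonalKernel (hs : ∀ n j, 0 < s n j)
    (hsum : ∀ n, ∑ j, s n j ^ 2 = 1) (hη_indep : ∀ n, iIndepFun (η n) (Pη n))
    (hη_law : ∀ n j, HasLaw (η n j) (gaussianReal 0 (Real.toNNReal (s n j ^ 2))) (Pη n))
    {c : unitInterval → ℝ}
    (hdiag : ∀ t : unitInterval, Tendsto (fun n => polygonalKernel (s n) t t) atTop (𝓝 (c t))) :
    ∃ (Ω : Type) (_ : MeasurableSpace Ω) (P : Measure Ω) (_ : IsProbabilityMeasure P)
      (Y : Ω → C(unitInterval, ℝ)),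
      TendstoInDistribution (fun n => polygonalProcess (s n) (η n)) atTop Y Pη P := by
  obtain ⟨Ω, hΩ, P, hP, W, hWm, hW⟩ := exists_wiener
  choose J hJ using exists_tendsto_polygonalInterp hs hsum hdiag
  have hIm : ∀ n, AEMeasurable (fun ω => polygonalInterp (s n) (hsum n) (W ω)) P := fun n =>
    (continuous_polygonalInterp (hsum n)).measurable.comp_aemeasurable hWm
  have hYm : AEMeasurable (fun ω => J (W ω)) P :=
    aemeasurable_of_tendsto_metrizable_ae atTop hIm (ae_of_all _ fun ω => hJ (W ω))
  -- Interpolations of one fixed Wiener process converge along every path; only the laws are then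
  -- transferred to `Y_n`.
  have hlim := tendstoInDistribution_of_ae_tendsto hIm hYm (ae_of_all _ fun ω => hJ (W ω))
  refine ⟨Ω, hΩ, P, hP, fun ω => J (W ω),
    fun n => aemeasurable_polygonalProcess fun j => (hη_law n j).aemeasurable, hYm, ?_⟩
  have h := hlim.tendsto
  simp_rw [fun n => map_polygonalInterp_wiener (hsum n) hW (hη_indep n) (hη_law n)] at h
  exact h

/-- The hypothesis says that the limiting bridge kernel vanishes at `(r,r)`; it dominates the value
at `(r,t)`. -/
theorem kernelLimit_eq_left (hs : ∀ n j, 0 < s n j) (hsum : ∀ n, ∑ j, s n j ^ 2 = 1)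
    {C : unitInterval → unitInterval → ℝ}
    (hlim : ∀ r t : unitInterval, Tendsto (fun n => polygonalKernel (s n) r t) atTop (𝓝 (C r t)))
    {r t : unitInterval} (hrt : r ≤ t) (hr : C r r = r) : C r t = r := by
  have hb : ∀ x : unitInterval, Tendsto (fun n => bridgeKernel (s n) r x) atTop
      (𝓝 ((r : ℝ) - C r x)) := fun x => by
    refine (tendsto_const_nhds.sub (hlim r x)).congr fun n => ?_
    linarith [polygonalKernel_add_bridgeKernel (t := (x : ℝ)) (hs n) (hsum n) r.2.1 r.2.2]
  have h1 := le_of_tendsto_of_tendsto' (hb t) (hb r) fun n =>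
    bridgeKernel_le_diag (s n) le_rfl hrt
  have h2 := ge_of_tendsto' (hb t) fun n => bridgeKernel_nonneg _ _ _
  linarith

/-- The continuous functions that are linear on `[a,b]` form a closed set. -/
theorem isClosed_linearOn (a b : unitInterval) :
    IsClosed {f : C(unitInterval, ℝ) | ∀ t ∈ Set.Icc a b,
      (f t - f a) * ((b : ℝ) - a) = (f b - f a) * ((t : ℝ) - a)} := by
  simp only [Set.ofPred_forall]
  exact isClosed_iInter fun t => isClosed_iInter fun _ =>
    isClosed_eq (by fun_prop) (by fun_prop)

theorem polygonal_linearOn {m : ℕ} {s : Fin m → ℝ} (hs : ∀ j, 0 < s j) (x : Fin m → ℝ)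
    {a b : unitInterval} {j : Fin m} (ha : knot s j ≤ a) (hb : (b : ℝ) ≤ knot s ((j : ℕ) + 1)) :
    ∀ t ∈ Set.Icc a b, (polygonal s x t - polygonal s x a) * ((b : ℝ) - a)
      = (polygonal s x b - polygonal s x a) * ((t : ℝ) - a) := by
  intro t ht
  have hat : (a : ℝ) ≤ t := ht.1
  have htb : (t : ℝ) ≤ b := ht.2
  rw [polygonal_apply_of_mem s x hs j t ⟨ha.trans hat, htb.trans hb⟩,
    polygonal_apply_of_mem s x hs j a ⟨ha, (hat.trans htb).trans hb⟩,
    polygonal_apply_of_mem s x hs j b ⟨(ha.trans hat).trans htb, hb⟩]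
  ring

variable {Ω : Type*} [MeasurableSpace Ω] {P : Measure Ω} [IsProbabilityMeasure P]
  {Y : Ω → C(unitInterval, ℝ)}

/-- Linearity on `[a,b]` is a closed condition, eventually of probability one for `Y_n`; portmanteau
preserves this. -/
theorem isLinearOn_of_eventually_segment (hs : ∀ n j, 0 < s n j)
    (h : TendstoInDistribution (fun n => polygonalProcess (s n) (η n)) atTop Y Pη P)
    {a b : unitInterval} (hab : a < b)
    (hseg : ∀ᶠ n in atTop, ∃ j : Fin (m n),
      knot (s n) j ≤ a ∧ (b : ℝ) ≤ knot (s n) ((j : ℕ) + 1)) : IsLinearOn Y P a b := by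
  have hF := isClosed_linearOn a b
  set F := {f : C(unitInterval, ℝ) | ∀ t ∈ Set.Icc a b,
      (f t - f a) * ((b : ℝ) - a) = (f b - f a) * ((t : ℝ) - a)} with hFdef
  have hev : ∀ᶠ n in atTop, (Pη n).map (polygonalProcess (s n) (η n)) F = 1 := by
    filter_upwards [hseg] with n ⟨j, hj1, hj2⟩
    rw [Measure.map_apply_of_aemeasurable (h.forall_aemeasurable n) hF.measurableSet]
    convert measure_univ (μ := Pη n)
    exact Set.eq_univ_of_forall fun ω => polygonal_linearOn (hs n) _ hj1 hj2
  have hport := ProbabilityMeasure.limsup_measure_closed_le_of_tendsto h.tendsto hF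
  have hone : 1 ≤ P.map Y F := by
    refine le_trans (le_of_eq ?_) hport
    exact (Tendsto.limsup_eq (tendsto_const_nhds.congr' (hev.mono fun n hn => hn.symm))).symm
  have hprob := Measure.isProbabilityMeasure_map (μ := P) h.aemeasurable_limit
  have hae : ∀ᵐ f ∂(P.map Y), f ∈ F :=
    (mem_ae_iff_prob_eq_one hF.measurableSet).2 (le_antisymm prob_le_one hone)
  filter_upwards [ae_of_ae_map h.aemeasurable_limit hae] with ω hω
  have hd : (b : ℝ) - a ≠ 0 := (sub_pos.2 (show (a : ℝ) < b from hab)).ne'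
  refine ⟨Y ω a - (Y ω b - Y ω a) / (b - a) * a, (Y ω b - Y ω a) / (b - a), fun t ht => ?_⟩
  have := hω t ht
  field_simp
  linarith

theorem isWienerOn_shift {C : unitInterval → unitInterval → ℝ}
    (hY : IsCentredGaussianCov (fun t ω => Y ω t) C P) {a b : unitInterval} (hab : a ≤ b)
    (hC : ∀ r ∈ Set.Icc a b, ∀ t ∈ Set.Icc a b, r ≤ t → C r t = r) :
    IsWienerOn ((b : ℝ) - a) (fun r ω => Y ω (shiftPoint a b r) - Y ω a) P := by
  classical
  have hm := hY.memLp
  have hmem : ∀ r, shiftPoint a b r ∈ Set.Icc a b := fun r =>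
    ⟨show (a : ℝ) ≤ a + r by linarith [r.2.1], show (a : ℝ) + r ≤ b by linarith [r.2.2]⟩
  have ha : a ∈ Set.Icc a b := ⟨le_rfl, hab⟩
  have hsymm : ∀ r t, C r t = C t r := fun r t => by
    rw [← hY.cov_eq, ← hY.cov_eq, covariance_comm]
  refine IsCentredGaussianCov.isWienerOn ⟨?_, fun r => ?_, fun r t => ?_⟩ fun ω => ?_
  · refine hY.isGaussian.of_isGaussianProcess fun r => ⟨{a, shiftPoint a b r},
      ContinuousLinearMap.proj ⟨shiftPoint a b r, by simp⟩
        - ContinuousLinearMap.proj ⟨a, by simp⟩, fun ω => rfl⟩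
  · rw [integral_sub ((hm _).integrable one_le_two) ((hm _).integrable one_le_two), hY.mean_eq,
      hY.mean_eq, sub_zero]
  · rw [covariance_fun_sub_fun_sub (hm _) (hm _) (hm _) (hm _)]
    simp only [hY.cov_eq]
    rw [hsymm _ a, hC a ha _ (hmem t) (hmem t).1, hC a ha _ (hmem r) (hmem r).1, hC a ha a ha le_rfl]
    rcases le_total r t with hrt | hrt
    · have hle : shiftPoint a b r ≤ shiftPoint a b t :=
        add_le_add_right (show (r : ℝ) ≤ t from hrt) (a : ℝ)
      rw [hC _ (hmem r) _ (hmem t) hle, min_eq_left (show (r : ℝ) ≤ t from hrt)]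
      simp only [shiftPoint]
      ring
    · have hle : shiftPoint a b t ≤ shiftPoint a b r :=
        add_le_add_right (show (t : ℝ) ≤ r from hrt) (a : ℝ)
      rw [hsymm, hC _ (hmem t) _ (hmem r) hle, min_eq_right (show (t : ℝ) ≤ r from hrt)]
      simp only [shiftPoint]
      ring
  · have : Continuous (shiftPoint a b) := by
      unfold shiftPoint
      fun_prop
    fun_prop

/-- An open subset of `[0,1]` without the end points is a countable union of segments. -/
theorem exists_countable_segments {U : Set unitInterval} (hU : IsOpen U) (h0 : 0 ∉ U)
    (h1 : 1 ∉ U) : ∃ S : Set (unitInterval × unitInterval), S.Countable ∧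
      (∀ p ∈ S, p.1 < p.2 ∧ Set.Icc p.1 p.2 ⊆ U) ∧ U = ⋃ p ∈ S, Set.Icc p.1 p.2 := by
  obtain ⟨D, hDc, hD⟩ := TopologicalSpace.exists_countable_dense unitInterval
  -- Segments with end points in a countable dense set suffice.
  refine ⟨{p | p ∈ D ×ˢ D ∧ p.1 < p.2 ∧ Set.Icc p.1 p.2 ⊆ U},
    (hDc.prod hDc).mono fun p hp => hp.1, fun p hp => hp.2, Set.Subset.antisymm (fun t ht => ?_)
    (Set.iUnion₂_subset fun p hp => hp.2.2)⟩
  have hlt0 : 0 < t := lt_of_le_of_ne t.2.1 (by rintro rfl; exact h0 ht)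
  have hlt1 : t < 1 := lt_of_le_of_ne t.2.2 (by rintro rfl; exact h1 ht)
  obtain ⟨l, u, ⟨hl, hu⟩, hlu⟩ := (mem_nhds_iff_exists_Ioo_subset' ⟨0, hlt0⟩ ⟨1, hlt1⟩).1
    (hU.mem_nhds ht)
  obtain ⟨c, hcD, hlc, hct⟩ := hD.exists_between hl
  obtain ⟨d, hdD, htd, hdu⟩ := hD.exists_between hu
  simp only [Set.mem_iUnion]
  exact ⟨(c, d), ⟨⟨hcD, hdD⟩, hct.trans htd,
    fun x hx => hlu ⟨hlc.trans_le hx.1, hx.2.trans_lt hdu⟩⟩, hct.le, htd.le⟩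

theorem exists_linear_decomposition (hs : ∀ n j, 0 < s n j) (hsum : ∀ n, ∑ j, s n j ^ 2 = 1)
    (hη_indep : ∀ n, iIndepFun (η n) (Pη n))
    (hη_law : ∀ n j, HasLaw (η n j) (gaussianReal 0 (Real.toNNReal (s n j ^ 2))) (Pη n))
    (h : TendstoInDistribution (fun n => polygonalProcess (s n) (η n)) atTop Y Pη P) :
    ∃ (A B : Set unitInterval) (S : Set (unitInterval × unitInterval)),
      S.Countable ∧
      (∀ p ∈ S, p.1 < p.2 ∧ IsLinearOn Y P p.1 p.2) ∧
      A = ⋃ p ∈ S, Set.Icc p.1 p.2 ∧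
      B = Aᶜ ∧
      ∀ a b : unitInterval, a ≤ b → Set.Icc a b ⊆ B →
        IsWienerOn ((b : ℝ) - a) (fun r ω => Y ω (shiftPoint a b r) - Y ω a) P := by
  obtain ⟨C, hC, hlim⟩ := IsCentredGaussianCov.of_tendstoInDistribution
    (fun n => isCentredGaussianCov_polygonalProcess (hη_indep n) (hη_law n)) h
  obtain ⟨G, hGC, hG⟩ := exists_tendsto_bridgeDiag hs hsum fun t => hlim t t
  have hev : ∀ k : unitInterval, Tendsto (fun n => bridgeKernel (s n) k k) atTop (𝓝 (G k)) :=
    fun k => ((continuous_eval_const (F := C(unitInterval, ℝ)) k).tendsto G).comp hG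
  have hGnn : ∀ k, 0 ≤ G k := fun k =>
    ge_of_tendsto' (hev k) fun n => bridgeKernel_nonneg _ _ _
  -- The points 0 and 1 are knots of every row, so `{G > 0}` omits them and is covered by
  -- nondegenerate closed segments inside it.
  have hG0 : G 0 = 0 := by
    refine tendsto_nhds_unique (hev 0) (tendsto_const_nhds.congr fun n => ?_)
    have := bridgeKernel_knot (hs n) 0
    rw [knot_zero] at this
    exact this.symm
  have hG1 : G 1 = 0 := by
    refine tendsto_nhds_unique (hev 1) (tendsto_const_nhds.congr fun n => ?_)
    have := bridgeKernel_knot (hs n) (m n)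
    rw [knot_last (hsum n)] at this
    exact this.symm
  obtain ⟨S, hSc, hS, hU⟩ := exists_countable_segments (U := {k | 0 < G k})
    (isOpen_lt continuous_const G.continuous) (by simp [hG0]) (by simp [hG1])
  refine ⟨_, _, S, hSc, fun p hp => ⟨(hS p hp).1, ?_⟩, hU, rfl, fun a b hab hB => ?_⟩
  · exact isLinearOn_of_eventually_segment hs h (hS p hp).1
      (eventually_exists_segment hs hsum hG (hS p hp).1.le fun k hk => (hS p hp).2 hk)
  · refine isWienerOn_shift hC hab fun r hr t _ hrt => kernelLimit_eq_left hs hsum hlim hrt ?_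
    have := le_antisymm (not_lt.1 fun hpos => hB hr hpos) (hGnn r)
    rw [hGC] at this
    linarith

theorem isWienerOn_of_mesh (hs : ∀ n j, 0 < s n j) (hsum : ∀ n, ∑ j, s n j ^ 2 = 1)
    (hη_indep : ∀ n, iIndepFun (η n) (Pη n))
    (hη_law : ∀ n j, HasLaw (η n j) (gaussianReal 0 (Real.toNNReal (s n j ^ 2))) (Pη n))
    {δ : ℕ → ℝ} (hδ : Tendsto δ atTop (𝓝 0)) (hsδ : ∀ n j, s n j ^ 2 ≤ δ n)
    (h : TendstoInDistribution (fun n => polygonalProcess (s n) (η n)) atTop Y Pη P) :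
    IsWienerOn 1 (fun t ω => Y ω t) P := by
  obtain ⟨C, hC, hlim⟩ := IsCentredGaussianCov.of_tendstoInDistribution
    (fun n => isCentredGaussianCov_polygonalProcess (hη_indep n) (hη_law n)) h
  have hCmin : C = fun r t : unitInterval => min (r : ℝ) t := by
    ext r t
    exact tendsto_nhds_unique (hlim r t) (tendsto_polygonalKernel_of_mesh hs hsum hδ hsδ r t)
  subst hCmin
  exact hC.isWienerOn fun ω => (Y ω).continuous

end Limit

theorem proposition2
    -- the `n`-th row has `m n` terms with standard deviations `s n j`
    (m : ℕ → ℕ) (s : (n : ℕ) → Fin (m n) → ℝ)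
    (hs_pos : ∀ n j, 0 < s n j) (hs_sum : ∀ n, ∑ j, s n j ^ 2 = 1)
    -- the array `ξ`: independent in each row, centred, with variances `(s n j) ^ 2`
    {Ωξ : ℕ → Type*} [∀ n, MeasurableSpace (Ωξ n)]
    (Pξ : (n : ℕ) → Measure (Ωξ n)) [∀ n, IsProbabilityMeasure (Pξ n)]
    (ξ : (n : ℕ) → Fin (m n) → Ωξ n → ℝ)
    (hξ_indep : ∀ n, iIndepFun (ξ n) (Pξ n))
    (hξ_memLp : ∀ n j, MemLp (ξ n j) 2 (Pξ n))
    (hξ_mean : ∀ n j, ∫ ω, ξ n j ω ∂(Pξ n) = 0)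
    (hξ_var : ∀ n j, ∫ ω, ξ n j ω ^ 2 ∂(Pξ n) = s n j ^ 2)
    -- the array `η`: independent in each row, normal with the same means and variances
    {Ωη : ℕ → Type*} [∀ n, MeasurableSpace (Ωη n)]
    (Pη : (n : ℕ) → Measure (Ωη n)) [∀ n, IsProbabilityMeasure (Pη n)]
    (η : (n : ℕ) → Fin (m n) → Ωη n → ℝ)
    (hη_indep : ∀ n, iIndepFun (η n) (Pη n))
    (hη_law : ∀ n j, HasLaw (η n j) (gaussianReal 0 (Real.toNNReal (s n j ^ 2))) (Pη n)) :
    -- convergence criterion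
    (∀ σ : unitInterval → ℝ, (∀ t, 0 ≤ σ t) →
      ((∃ (Ω : Type) (_ : MeasurableSpace Ω) (P : Measure Ω) (_ : IsProbabilityMeasure P)
          (Y : Ω → C(unitInterval, ℝ)),
          IsCentredGaussianWith σ Y P ∧
          TendstoInDistribution (fun n => polygonalProcess (s n) (η n)) atTop Y Pη P) ↔
        ∀ t, Tendsto
          (fun n => rootSecondMoment (polygonalProcess (s n) (ξ n)) (Pξ n) t) atTop (𝓝 (σ t)))) ∧
    -- the classical case
    (Tendsto (fun n => ⨆ j, s n j) atTop (𝓝 0) →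
      (∀ t : unitInterval, Tendsto
        (fun n => rootSecondMoment (polygonalProcess (s n) (ξ n)) (Pξ n) t) atTop
        (𝓝 √(t : ℝ))) ∧
      (∀ {Ω : Type*} [MeasurableSpace Ω] (P : Measure Ω) [IsProbabilityMeasure P]
        (Y : Ω → C(unitInterval, ℝ)),
        TendstoInDistribution (fun n => polygonalProcess (s n) (η n)) atTop Y Pη P →
        IsWienerOn 1 (fun t ω => Y ω t) P)) ∧
    -- the structure of the limit in the general case
    (∀ {Ω : Type*} [MeasurableSpace Ω] (P : Measure Ω) [IsProbabilityMeasure P]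
      (Y : Ω → C(unitInterval, ℝ)),
      TendstoInDistribution (fun n => polygonalProcess (s n) (η n)) atTop Y Pη P →
      ∃ (A B : Set unitInterval) (S : Set (unitInterval × unitInterval)),
        S.Countable ∧
        (∀ p ∈ S, p.1 < p.2 ∧ IsLinearOn Y P p.1 p.2) ∧
        A = ⋃ p ∈ S, Set.Icc p.1 p.2 ∧
        B = Aᶜ ∧
        ∀ a b : unitInterval, a ≤ b → Set.Icc a b ⊆ B →
          IsWienerOn ((b : ℝ) - a) (fun r ω => Y ω (shiftPoint a b r) - Y ω a) P) := by
  have hroot : ∀ n t, rootSecondMoment (polygonalProcess (s n) (ξ n)) (Pξ n) t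
      = √(polygonalKernel (s n) t t) := fun n t =>
    rootSecondMoment_polygonalProcess (hξ_indep n) (hξ_memLp n) (hξ_mean n) (hξ_var n) t
  have hgauss := fun n => isCentredGaussianCov_polygonalProcess (hη_indep n) (hη_law n)
  have hKnn : ∀ n (t : unitInterval), 0 ≤ polygonalKernel (s n) t t := fun n t =>
    Finset.sum_nonneg fun j _ => mul_nonneg (sq_nonneg _) (mul_self_nonneg _)
  simp only [hroot]
  refine ⟨fun σ hσ => ⟨?_, fun hlim => ?_⟩, fun hmesh => ?_, fun P _ Y h =>
    exists_linear_decomposition hs_pos hs_sum hη_indep hη_law h⟩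
  · rintro ⟨Ω, _, P, _, Y, hY, h⟩ t
    obtain ⟨C, hC, hlim⟩ := IsCentredGaussianCov.of_tendstoInDistribution hgauss h
    have hCσ : C t t = σ t ^ 2 := by rw [← hC.secondMoment, hY.secondMoment_eq]
    rw [← Real.sqrt_sq (hσ t), ← hCσ]
    exact (hlim t t).sqrt
  · have hdiag : ∀ t : unitInterval,
        Tendsto (fun n => polygonalKernel (s n) t t) atTop (𝓝 (σ t ^ 2)) := fun t =>
      ((hlim t).pow 2).congr fun n => Real.sq_sqrt (hKnn n t)
    obtain ⟨Ω, _, P, _, Y, h⟩ :=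
      exists_limit_of_tendsto_polygonalKernel hs_pos hs_sum hη_indep hη_law hdiag
    obtain ⟨C, hC, hC'⟩ := IsCentredGaussianCov.of_tendstoInDistribution hgauss h
    refine ⟨Ω, _, P, _, Y, ⟨hC.isGaussian, hC.mean_eq, fun t => ?_⟩, h⟩
    rw [hC.secondMoment]
    exact tendsto_nhds_unique (hC' t t) (hdiag t)
  · have hδ : Tendsto (fun n => (⨆ j, s n j) ^ 2) atTop (𝓝 0) := by
      simpa using hmesh.pow 2
    have hsδ : ∀ n j, s n j ^ 2 ≤ (⨆ j, s n j) ^ 2 := fun n j =>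
      pow_le_pow_left₀ (hs_pos n j).le (le_ciSup (Set.finite_range (s n)).bddAbove j) 2
    refine ⟨fun t => ?_, fun P _ Y h =>
      isWienerOn_of_mesh hs_pos hs_sum hη_indep hη_law hδ hsδ h⟩
    have := (tendsto_polygonalKernel_of_mesh hs_pos hs_sum hδ hsδ t t).sqrt
    rwa [min_self] at this
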